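/- **Lemma (privacy of ADP-Screen).** Fix $d\ge 1$, $\lambda>0$, $\varepsilon_1,\varepsilon_2>0$, $0<\delta_1,\delta_2\le 1$, a number of iterations $T$, a set $I\subseteq\{1,\dots,T\}$ of screening iterations with $l=|I|$, step sizes $\eta_t\in[0,1]$, and let $\mathcal C=\{w\in\mathbb R^d:\|w\|_1\le\lambda\}$. A data set is a pair $(X,y)$, $X\in\mathbb R^{n\times d}$ with rows $x_1,\dots,x_n$, $y\in\mathbb R^n$, where $n\ge 1$ may vary, $\|x_i\|_\infty\le 1$ and $|y_i|<\lambda$ for all $i$. Two data sets are adjacent if one arises from the other by removing one record $(x_i,y_i)$. Let $\mathcal D$ be any class of such data sets (for instance all of them, or those with $n_0$ or $n_0+1$ records). A randomized algorithm $\mathcal A$ is $(\varepsilon,\delta)$-differentially private on $\mathcal D$ if $\mathbb P[\mathcal A(D)\in O]\le e^{\varepsilon}\,\mathbb P[\mathcal A(D')\in O]+\delta$ for all adjacent $D,D'\in\mathcal D$ and all measurable $O$. For a data set let $f(u)=\frac1n (y-u)^\top(y-u)$ on $\mathbb R^n$, which is $L$-smooth and $\mu$-strongly convex with $L=\mu=\frac2n$;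 let $\mathcal G_{\mathcal C}(w)=\max_{z\in\mathcal C}(Xw-Xz)^\top\nabla f(Xw)$, let $x_{(i)}$ be the $i$-th column of $X$, and let the screening vector $s(w)\in\mathbb R^d$ be $$s_i(w)=|x_{(i)}^\top\nabla f(Xw)|+(Xw)^\top\nabla f(Xw)+L\big(\|x_{(i)}\|_2+\|Xw\|_2\big)\sqrt{\mathcal G_{\mathcal C}(w)/\mu}.$$ Let $\Delta_2$ be (an upper bound on) the $L_2$-sensitivity of $s$: $\|s_D(w)-s_{D'}(w)\|_2\le\Delta_2$ for all adjacent $D,D'\in\mathcal D$ and all $w\in\mathcal C$. Put $$\delta_{\rm iter}=\frac{\delta_2}{l+1},\qquad \varepsilon_{\rm iter}=\frac{\varepsilon_2}{2\sqrt{2l\log(1/\delta_{\rm iter})}},\qquad \sigma^2=\frac{2\Delta_2^2\log(1.25/\delta_{\rm iter})}{\varepsilon_{\rm iter}^2}.$$ ADP-Screen draws $w^{(0)}$ from an arbitrary data-independent probability law on $\mathcal C$. Then, for $t=1,\dots,T$, with fresh independent noise in every iteration, it does the following. 1. (DP-FW step) For each of the $2d$ vertices $v\in\{\pm\lambda e_1,\dots,\pm\lambda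 e_d\}$ of $\mathcal C$ let $\alpha_v=\langle v,\nabla_w f(Xw)|_{w=w^{(t-1)}}\rangle+\mathrm{Lap}(b)$ with independent Laplace noise of scale $$b=\frac{L_1\cdot 2\lambda\cdot\sqrt{8T\log(1/\delta_1)}}{n\,\varepsilon_1},$$ where $L_1=4\lambda$ is the Lipschitz constant with respect to $\|\cdot\|_1$ on $\mathcal C$ of the loss $(y_0-w\cdot x_0)^2$ of one record, and $2\lambda$ is the $\ell_1$-diameter of $\mathcal C$. Set $w^{(t)}=(1-\eta_t)w^{(t-1)}+\eta_t v^*$, where $v^*$ minimizes $\alpha_v$ (ties broken by a fixed order). 2. (Screening) If $t\in I$, compute $\tilde s=s(w^{(t)})+\mathcal N(0,\sigma^2 I_d)$ and set $w^{(t)}_j\leftarrow 0$ for all $j$ with $\tilde s_j<0$. The output is $w^{(T)}$. Assume $\varepsilon_1\le 8\log(1/\delta_1)$ if $\delta_1<1$, and $\varepsilon_2\le 8\log(1/\delta_{\rm iter})$ if $\delta_2<1$. Then ADP-Screen is $(\varepsilon_1+\varepsilon_2,\ \delta_1+\delta_2)$-differentially private on $\mathcal D$. -/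

import Mathlib

open MeasureTheory ProbabilityTheory
open scoped NNReal ENNReal

noncomputable section

namespace ADPScreen

/-! ### Data sets, adjacency and differential privacy -/

/-- A regression data set: a design matrix whose rows are the `n` data points, and a target. -/
structure Dataset (d : ℕ) where
  n : ℕ
  X : Matrix (Fin n) (Fin d) ℝ
  y : EuclideanSpace ℝ (Fin n)

/-- The data set `(X, y)` with its `i`-th record `(xᵢ, yᵢ)` removed. -/
def removeRecord {d n : ℕ} (X : Matrix (Fin (n + 1)) (Fin d) ℝ)
    (y : EuclideanSpace ℝ (Fin (n + 1))) (i : Fin (n + 1)) : Dataset d where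
  n := n
  X := X.submatrix i.succAbove id
  y := WithLp.toLp 2 fun k => y (i.succAbove k)

/-- `D'` arises from `D` by removing one record. -/
def RemovesOne {d : ℕ} (D D' : Dataset d) : Prop :=
  ∃ (n : ℕ) (X : Matrix (Fin (n + 1)) (Fin d) ℝ) (y : EuclideanSpace ℝ (Fin (n + 1)))
    (i : Fin (n + 1)), D = ⟨n + 1, X, y⟩ ∧ D' = removeRecord X y i

/-- Add/remove adjacency. -/
def Adjacent {d : ℕ} (D D' : Dataset d) : Prop := RemovesOne D D' ∨ RemovesOne D' D

/-- The standing assumptions on a data set: it is nonempty, `‖xᵢ‖_∞ ≤ 1` and `|yᵢ| < lam`. -/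
def Admissible {d : ℕ} (lam : ℝ) (D : Dataset d) : Prop :=
  0 < D.n ∧ (∀ i j, |D.X i j| ≤ 1) ∧ ∀ i, |D.y i| < lam

/-- `A`, which maps a data set to the law of the output, is `(ε, δ)`-differentially private on
the class `𝒟` of data sets. -/
def IsDP {d : ℕ} {Ω : Type*} [MeasurableSpace Ω] (𝒟 : Set (Dataset d))
    (A : Dataset d → Measure Ω) (ε δ : ℝ) : Prop :=
  ∀ D ∈ 𝒟, ∀ D' ∈ 𝒟, Adjacent D D' → ∀ O : Set Ω, MeasurableSet O →
    A D O ≤ ENNReal.ofReal (Real.exp ε) * A D' O + ENNReal.ofReal δ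

/-! ### The loss, the Wolfe gap and the screening vector -/

/-- The `lam`-scaled `L₁` ball, the feasible region `𝒞`. -/
def l1Ball (d : ℕ) (lam : ℝ) : Set (EuclideanSpace ℝ (Fin d)) := {w | ∑ j, |w j| ≤ lam}

namespace Dataset

variable {d : ℕ} (D : Dataset d)

/-- `X w`. -/
def predict (w : EuclideanSpace ℝ (Fin d)) : EuclideanSpace ℝ (Fin D.n) :=
  WithLp.toLp 2 (D.X.mulVec w.ofLp)

/-- `f(u) = (1/n) (y - u)ᵀ (y - u)`. -/
def loss (u : EuclideanSpace ℝ (Fin D.n)) : ℝ := 1 / (D.n : ℝ) * ∑ i, (D.y i - u i) ^ 2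

/-- `∇f(X w)`, the gradient of `f` with respect to `u`, at `u = X w`. -/
def gradAt (w : EuclideanSpace ℝ (Fin d)) : EuclideanSpace ℝ (Fin D.n) :=
  gradient D.loss (D.predict w)

/-- The smoothness constant `L` of `f`; its Hessian is `(2/n) I`. -/
def smoothConst : ℝ := 2 / (D.n : ℝ)

/-- The strong convexity constant `μ` of `f`; its Hessian is `(2/n) I`. -/
def convexConst : ℝ := 2 / (D.n : ℝ)

/-- The Wolfe gap `max_{z ∈ 𝒞} (X w - X z)ᵀ ∇f(X w)` (a maximum over a compact set). -/
def wolfeGap (lam : ℝ) (w : EuclideanSpace ℝ (Fin d)) : ℝ :=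
  ⨆ z : l1Ball d lam, inner ℝ (D.predict w - D.predict z) (D.gradAt w)

/-- The `i`-th column of the design matrix. -/
def column (i : Fin d) : EuclideanSpace ℝ (Fin D.n) := WithLp.toLp 2 fun k => D.X k i

/-- The screening vector `s`:
`sᵢ = |x₍ᵢ₎ᵀ ∇f(Xw)| + (Xw)ᵀ ∇f(Xw) + L (‖x₍ᵢ₎‖₂ + ‖Xw‖₂) √(𝒢(w) / μ)`. -/
def screenVector (lam : ℝ) (w : EuclideanSpace ℝ (Fin d)) : EuclideanSpace ℝ (Fin d) :=
  WithLp.toLp 2 fun i =>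
    |inner ℝ (D.column i) (D.gradAt w)| + inner ℝ (D.predict w) (D.gradAt w) +
      D.smoothConst * (‖D.column i‖ + ‖D.predict w‖) *
        √(D.wolfeGap lam w / D.convexConst)

/-- The training objective `w ↦ f(X w)`. -/
def objective (w : EuclideanSpace ℝ (Fin d)) : ℝ := D.loss (D.predict w)

end Dataset

/-- `Δ₂` bounds the `L₂`-sensitivity of the screening vector: its change between adjacent data
sets, at the same feasible point `w`, has Euclidean norm at most `Δ₂`. -/
def HasL2Sensitivity {d : ℕ} (𝒟 : Set (Dataset d)) (lam Δ₂ : ℝ) : Prop :=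
  ∀ D ∈ 𝒟, ∀ D' ∈ 𝒟, Adjacent D D' → ∀ w ∈ l1Ball d lam,
    ‖D.screenVector lam w - D'.screenVector lam w‖ ≤ Δ₂

/-! ### Parameters -/

/-- The data-independent inputs of the algorithm. `stepSize t` is the step size of the
Frank-Wolfe update of iteration `t`, and `init` the law of the starting point. -/
structure Params (d : ℕ) where
  ε₁ : ℝ
  ε₂ : ℝ
  δ₁ : ℝ
  δ₂ : ℝ
  lam : ℝ
  T : ℕ
  Δ₂ : ℝ
  I : Finset ℕ
  stepSize : ℕ → ℝ
  init : Measure (EuclideanSpace ℝ (Fin d))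

namespace Params

variable {d : ℕ} (p : Params d)

/-- The number `l` of screening iterations. -/
def l : ℕ := p.I.card

def δiter : ℝ := p.δ₂ / ((p.l : ℝ) + 1)

def εiter : ℝ := p.ε₂ / (2 * √(2 * (p.l : ℝ) * Real.log (1 / p.δiter)))

/-- The variance `σ²` of the screening noise. -/
def variance : ℝ := 2 * p.Δ₂ ^ 2 * Real.log (1.25 / p.δiter) / p.εiter ^ 2

/-- The scale of the Laplace noise in `DP-FW Step` on `n` records,
`L₁ · diam₁(𝒞) · √(8 T log(1/δ₁)) / (n ε₁)`, where `diam₁(𝒞) = 2 lam` is the `L₁`-diameter of the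
feasible region and `L₁ = 4 lam` the Lipschitz constant, with respect to `‖·‖₁` on `𝒞`, of the
loss `(y - w · x)²` of a single record. -/
def fwScale (n : ℕ) : ℝ :=
  4 * p.lam * (2 * p.lam) * √(8 * (p.T : ℝ) * Real.log (1 / p.δ₁)) / ((n : ℝ) * p.ε₁)

end Params

/-! ### Noise -/

/-- The Laplace distribution with mean `0` and scale `b`, a point mass when `b = 0`. -/
def laplaceReal (b : ℝ≥0) : Measure ℝ :=
  if b = 0 then Measure.dirac 0
  else volume.withDensity fun x => ENNReal.ofReal (1 / (2 * (b : ℝ)) * Real.exp (-|x| / b))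

/-- The law of a vector of independent Laplace variables of scale `b`. -/
def laplaceNoise (ι : Type) [Fintype ι] (b : ℝ) : Measure (ι → ℝ) :=
  Measure.pi fun _ => laplaceReal b.toNNReal

/-- The law `N(0, v I_d)`. -/
def gaussianNoise (d : ℕ) (v : ℝ) : Measure (Fin d → ℝ) :=
  Measure.pi fun _ => gaussianReal 0 v.toNNReal

/-! ### The algorithm -/

/-- Indices of the `2 d` vertices of the `L₁` ball: a coordinate and a sign. -/
abbrev Vertex (d : ℕ) : Type := Fin d ×ₗ Bool

/-- The vertex `lam e_j` or `-lam e_j`. -/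
def vertexPoint {d : ℕ} (lam : ℝ) (k : Vertex d) : EuclideanSpace ℝ (Fin d) :=
  EuclideanSpace.single (ofLex k).1 (if (ofLex k).2 then lam else -lam)

lemma exists_minimizer {ι : Type} [Fintype ι] [Nonempty ι] (α : ι → ℝ) :
    (Finset.univ.filter fun k => ∀ j, α k ≤ α j).Nonempty := by
  obtain ⟨k, -, hk⟩ := Finset.exists_min_image Finset.univ α Finset.univ_nonempty
  exact ⟨k, by simpa using hk⟩

/-- The index of the smallest entry of `α` (the first one in case of a tie). -/
def argminIndex {ι : Type} [Fintype ι] [Nonempty ι] [LinearOrder ι] (α : ι → ℝ) : ι :=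
  (Finset.univ.filter fun k => ∀ j, α k ≤ α j).min' (exists_minimizer α)

instance vertexNonempty {d : ℕ} [NeZero d] : Nonempty (Vertex d) := ⟨toLex (0, true)⟩

variable {d : ℕ} [NeZero d]

/-- `DP-FW Step` with step size `η` and noise vector `r`: report-noisy-min selects a vertex by its
inner product with the gradient of the objective, and the iterate moves towards that vertex. -/
def fwStep (D : Dataset d) (lam η : ℝ) (w : EuclideanSpace ℝ (Fin d)) (r : Vertex d → ℝ) :
    EuclideanSpace ℝ (Fin d) :=
  (1 - η) • w + η • vertexPoint lam
    (argminIndex fun k => inner ℝ (vertexPoint lam k) (gradient D.objective w) + r k)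

/-- Set `w_j` to `0` for all `j` with `s_j < 0`. -/
def zeroOut (s w : EuclideanSpace ℝ (Fin d)) : EuclideanSpace ℝ (Fin d) :=
  WithLp.toLp 2 fun j => if s j < 0 then 0 else w j

/-- Iteration `t` of the algorithm, from the previous iterate `w`, with the Laplace noise `r` of
`DP-FW Step` and the Gaussian noise `g` of the screening step. -/
def iteration (p : Params d) (D : Dataset d) (t : ℕ) (w : EuclideanSpace ℝ (Fin d))
    (r : Vertex d → ℝ) (g : Fin d → ℝ) : EuclideanSpace ℝ (Fin d) :=
  let w' := fwStep D p.lam (p.stepSize t) w r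
  if t ∈ p.I then zeroOut (D.screenVector p.lam w' + WithLp.toLp 2 g) w' else w'

/-- The law of the `t`-th iterate: the noise of each iteration is drawn afresh, independently of
the previous iterate. -/
def iterateLaw (p : Params d) (D : Dataset d) : ℕ → Measure (EuclideanSpace ℝ (Fin d))
  | 0 => p.init
  | t + 1 =>
    ((iterateLaw p D t).prod
      ((laplaceNoise (Vertex d) (p.fwScale D.n)).prod (gaussianNoise d p.variance))).map
      fun ω => iteration p D (t + 1) ω.1 ω.2.1 ω.2.2

/-- `ADP-Screen`: the law of its output, the last iterate. -/
def adpScreen (p : Params d) (D : Dataset d) : Measure (EuclideanSpace ℝ (Fin d)) :=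
  iterateLaw p D p.T

end ADPScreen

end

/-! Privacy is accounted for in concentrated form. At an order `a`, `RenyiLE a ρ` bounds the Rényi
divergence by `a * ρ`, and the budgets `ρ` add under adaptive composition (`RenyiLE.comp`), so the
whole run has one total budget, converted to approximate privacy only at the end.

A DP-FW step is report-noisy-min, which is purely private, and pure `ε`-privacy costs `ε² / 2`
(`RenyiLE.of_pure`). Its noise scale depends on `n`, and adjacent data sets differ in `n`. But an
argmin is unchanged when scores and noise are multiplied by `n` (`noisyArgmin_mul`): the scale
becomes the constant `fwBudget`, and `n` times the gradient is a sum over records, so removing a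
record changes a score by one summand, at most `4 lam²` (`Adjacent.abs_sub_le`). A screening step is
a Gaussian mechanism followed by post-processing and costs `Δ₂² / (2σ²)`.

The `T` Frank-Wolfe steps cost at most `A = ε₁² / (16 log(1/δ₁))`. The screenings cost at most `B =
ε₂² / (32 log(1/δiter) log(1.25/δiter))` if there are any, and `B = 0` otherwise. With `ρ = A + B`
and `δ = δ₁ + δ₂ < 1`, the best order gives `ε = ρ + 2√(ρ log(1/δ))` (`exists_order`). Subadditivity
of the square root splits this into a part for `A` and a part for `B`, and the assumed upper bounds
on `ε₁` and `ε₂` keep the parts below `ε₁` and `ε₂`. For `δ ≥ 1` there is nothing to prove. -/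

noncomputable section

namespace ADPScreen

section

/-! ### Rényi domination -/

/-- The Rényi divergence of order `a` of `μ` from `ν` is at most `a * ρ`, in dual form: the density
of `μ` with respect to `ν` has `Lᵃ(ν)`-norm at most `exp ((a - 1) * ρ)`. -/
def RenyiLE {Ω : Type*} [MeasurableSpace Ω] (a ρ : ℝ) (μ ν : Measure Ω) : Prop :=
  ∀ f : Ω → ℝ≥0∞, Measurable f →
    ∫⁻ x, f x ∂μ ≤ ENNReal.ofReal (Real.exp ((a - 1) * ρ)) *
      (∫⁻ x, f x ^ a.conjExponent ∂ν) ^ (1 / a.conjExponent)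

lemma one_div_conjExponent (a : ℝ) : 1 / a.conjExponent = (a - 1) / a := by
  rw [Real.conjExponent, one_div_div]

lemma conjExponent_pos {a : ℝ} (ha : 1 < a) : 0 < a.conjExponent :=
  (Real.HolderConjugate.conjExponent ha).symm.pos

namespace RenyiLE

variable {Ω Ω' : Type*} [MeasurableSpace Ω] [MeasurableSpace Ω'] {a ρ ρ' : ℝ} {μ ν : Measure Ω}

lemma mono (ha : 1 < a) (h : RenyiLE a ρ μ ν) (hρ : ρ ≤ ρ') : RenyiLE a ρ' μ ν := by
  intro f hf
  refine (h f hf).trans ?_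
  gcongr

/-- Hölder's inequality; the `a`-th root turns the exponent `a (a - 1) ρ` into `(a - 1) ρ`. -/
lemma of_withDensity (ha : 1 < a) {g : Ω → ℝ≥0∞} (hg : Measurable g)
    (hμ : μ = ν.withDensity g)
    (h : ∫⁻ x, g x ^ a ∂ν ≤ ENNReal.ofReal (Real.exp (a * (a - 1) * ρ))) :
    RenyiLE a ρ μ ν := by
  intro f hf
  have h0 : (0 : ℝ) < a := by linarith
  rw [hμ, lintegral_withDensity_eq_lintegral_mul _ hg hf]
  refine (ENNReal.lintegral_mul_le_Lp_mul_Lq ν (Real.HolderConjugate.conjExponent ha)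
    hg.aemeasurable hf.aemeasurable).trans ?_
  gcongr
  refine (ENNReal.rpow_le_rpow h (by positivity)).trans ?_
  rw [ENNReal.ofReal_rpow_of_pos (Real.exp_pos _), ← Real.exp_mul]
  apply le_of_eq
  congr 2
  field_simp

lemma refl (ha : 1 < a) (μ : Measure Ω) [IsProbabilityMeasure μ] : RenyiLE a 0 μ μ :=
  of_withDensity ha (g := fun _ => 1) measurable_const (by simp) (by simp)

/-- Data processing. In dual form it is a change of variables, and no density of the image law is
needed. -/
lemma map (h : RenyiLE a ρ μ ν) {φ : Ω → Ω'} (hφ : Measurable φ) :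
    RenyiLE a ρ (μ.map φ) (ν.map φ) := by
  intro f hf
  rw [lintegral_map hf hφ, lintegral_map (by fun_prop) hφ]
  exact h _ (hf.comp hφ)

/-- Adaptive composition. -/
lemma comp (ha : 1 < a) {N₁ N₂ Ω₁ : Type*} [MeasurableSpace N₁] [MeasurableSpace N₂]
    [MeasurableSpace Ω₁] {κ₁ : Measure N₁} {κ₂ : Measure N₂} [SFinite κ₁] [SFinite κ₂]
    [SFinite μ] [SFinite ν] {F₁ : Ω × N₁ → Ω₁} {F₂ : Ω × N₂ → Ω₁} (hF₁ : Measurable F₁)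
    (hF₂ : Measurable F₂) (h : RenyiLE a ρ μ ν)
    (h' : ∀ᵐ x ∂μ, RenyiLE a ρ' (κ₁.map fun y => F₁ (x, y)) (κ₂.map fun y => F₂ (x, y))) :
    RenyiLE a (ρ + ρ') ((μ.prod κ₁).map F₁) ((ν.prod κ₂).map F₂) := by
  intro f hf
  have hb := conjExponent_pos ha
  have hf' : Measurable fun x => f x ^ a.conjExponent := by fun_prop
  rw [lintegral_map hf hF₁, lintegral_map hf' hF₂, lintegral_prod _ (by fun_prop),
    lintegral_prod _ (by fun_prop)]
  -- The inner bound leaves `G ^ (1 / a.conjExponent)`, which is again a test function, so the dual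
  -- bound for `μ` and `ν` applies to it.
  set G : Ω → ℝ≥0∞ := fun x => ∫⁻ y, f (F₂ (x, y)) ^ a.conjExponent ∂κ₂ with hG
  have hGm : Measurable G := (hf'.comp hF₂).lintegral_prod_right'
  have hGm' : Measurable fun x => G x ^ (1 / a.conjExponent) := by fun_prop
  calc ∫⁻ x, ∫⁻ y, f (F₁ (x, y)) ∂κ₁ ∂μ
      ≤ ∫⁻ x, ENNReal.ofReal (Real.exp ((a - 1) * ρ')) * G x ^ (1 / a.conjExponent) ∂μ := by
        refine lintegral_mono_ae ?_
        filter_upwards [h'] with x hx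
        have := hx f hf
        rwa [lintegral_map hf (by fun_prop), lintegral_map hf' (by fun_prop)] at this
    _ = ENNReal.ofReal (Real.exp ((a - 1) * ρ')) * ∫⁻ x, G x ^ (1 / a.conjExponent) ∂μ :=
        lintegral_const_mul _ hGm'
    _ ≤ ENNReal.ofReal (Real.exp ((a - 1) * ρ')) * (ENNReal.ofReal (Real.exp ((a - 1) * ρ)) *
          (∫⁻ x, (G x ^ (1 / a.conjExponent)) ^ a.conjExponent ∂ν) ^ (1 / a.conjExponent)) := by
        gcongr
        exact h _ hGm'
    _ = _ := by
        rw [← mul_assoc, ← ENNReal.ofReal_mul (Real.exp_pos _).le, ← Real.exp_add]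
        simp_rw [← ENNReal.rpow_mul, one_div_mul_cancel hb.ne', ENNReal.rpow_one]
        congr 4
        ring

/-- Conversion of a Rényi bound to approximate differential privacy. -/
lemma measure_le (ha : 1 < a) [IsFiniteMeasure ν] (h : RenyiLE a ρ μ ν) {ε δ : ℝ} (hδ : 0 < δ)
    (hε : a * ρ + Real.log (1 / δ) / (a - 1) ≤ ε) {O : Set Ω} (hO : MeasurableSet O) :
    μ O ≤ ENNReal.ofReal (Real.exp ε) * ν O + ENNReal.ofReal δ := by
  have hb := conjExponent_pos ha
  have h1 := h (O.indicator 1) (measurable_one.indicator hO)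
  have h2 : (fun x => O.indicator (1 : Ω → ℝ≥0∞) x ^ a.conjExponent) = O.indicator 1 := by
    ext x
    by_cases hx : x ∈ O <;> simp [hx, hb]
  rw [h2, lintegral_indicator_one hO, lintegral_indicator_one hO, one_div_conjExponent] at h1
  refine h1.trans ?_
  have hq : ν O ≠ ∞ := measure_ne_top ν O
  rw [← ENNReal.ofReal_toReal hq]
  set q := (ν O).toReal
  have hq0 : 0 ≤ q := ENNReal.toReal_nonneg
  have ha0 : 0 < a := by linarith
  have ha1 : 0 < a - 1 := by linarith
  rw [ENNReal.ofReal_rpow_of_nonneg hq0 (by positivity), ← ENNReal.ofReal_mul (by positivity),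
    ← ENNReal.ofReal_mul (by positivity), ← ENNReal.ofReal_add (by positivity) hδ.le]
  apply ENNReal.ofReal_le_ofReal
  have hw : 1 / a + (a - 1) / a = 1 := by field_simp; ring
  -- Testing on an indicator bounds `μ O` by a multiple of `q ^ ((a - 1) / a)`. Young's inequality
  -- with weights `1 / a` and `(a - 1) / a` separates `δ` from `exp ε * q`.
  have key := Real.geom_mean_le_arith_mean2_weighted (w₁ := 1 / a) (w₂ := (a - 1) / a) (p₁ := δ)
    (p₂ := Real.exp ε * q) (by positivity) (by positivity) hδ.le (by positivity) hw
  have hexp : Real.exp ((a - 1) * ρ) ≤ δ ^ (1 / a) * Real.exp ε ^ ((a - 1) / a) := by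
    rw [Real.rpow_def_of_pos hδ, ← Real.exp_mul, ← Real.exp_add, Real.exp_le_exp]
    rw [one_div, Real.log_inv] at hε
    have : (a - 1) * (a * ρ + -Real.log δ / (a - 1)) ≤ (a - 1) * ε := by gcongr
    rw [mul_add, mul_div_cancel₀ _ ha1.ne'] at this
    rw [show Real.log δ * (1 / a) + ε * ((a - 1) / a) = (Real.log δ + (a - 1) * ε) / a by
      field_simp, le_div_iff₀ ha0]
    linarith
  calc Real.exp ((a - 1) * ρ) * q ^ ((a - 1) / a)
      ≤ δ ^ (1 / a) * Real.exp ε ^ ((a - 1) / a) * q ^ ((a - 1) / a) := by gcongr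
    _ = δ ^ (1 / a) * (Real.exp ε * q) ^ ((a - 1) / a) := by
        rw [Real.mul_rpow (Real.exp_pos _).le hq0, mul_assoc]
    _ ≤ 1 / a * δ + (a - 1) / a * (Real.exp ε * q) := key
    _ ≤ 1 * δ + 1 * (Real.exp ε * q) := by
        have e1 : 0 ≤ 1 / a := by positivity
        have e2 : 0 ≤ (a - 1) / a := by positivity
        gcongr <;> linarith
    _ = _ := by ring

end RenyiLE

/-! ### Pure differential privacy -/

/-- The derivative has the sign of `sinh s - s cosh s`, which vanishes at `0` and has derivative `-s
sinh s ≤ 0`. -/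
lemma cosh_mul_exp_antitoneOn :
    AntitoneOn (fun s : ℝ => Real.cosh s * Real.exp (-(s ^ 2 / 2))) (Set.Ici 0) := by
  have hd : ∀ s : ℝ, HasDerivAt (fun s : ℝ => Real.cosh s * Real.exp (-(s ^ 2 / 2)))
      ((Real.sinh s - s * Real.cosh s) * Real.exp (-(s ^ 2 / 2))) s := by
    intro s
    have h1 : HasDerivAt (fun s : ℝ => -(s ^ 2 / 2)) (-s) s := by
      exact ((hasDerivAt_pow 2 s).div_const 2).neg.congr_deriv (by norm_num)
    exact ((Real.hasDerivAt_cosh s).mul h1.exp).congr_deriv (by ring)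
  have hk : ∀ s : ℝ, HasDerivAt (fun s : ℝ => Real.sinh s - s * Real.cosh s)
      (-(s * Real.sinh s)) s := by
    intro s
    exact ((Real.hasDerivAt_sinh s).sub ((hasDerivAt_id s).mul (Real.hasDerivAt_cosh s))).congr_deriv
      (by simp)
  have hanti : AntitoneOn (fun s : ℝ => Real.sinh s - s * Real.cosh s) (Set.Ici 0) := by
    refine antitoneOn_of_deriv_nonpos (convex_Ici 0)
      (fun s _ => (hk s).continuousAt.continuousWithinAt)
      (fun s _ => (hk s).differentiableAt.differentiableWithinAt) fun s hs => ?_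
    rw [interior_Ici] at hs
    rw [(hk s).deriv]
    have := Real.sinh_nonneg_iff.2 (le_of_lt hs)
    have : 0 ≤ s * Real.sinh s := mul_nonneg (le_of_lt hs) this
    linarith
  refine antitoneOn_of_deriv_nonpos (convex_Ici 0)
    (fun s _ => (hd s).continuousAt.continuousWithinAt)
    (fun s _ => (hd s).differentiableAt.differentiableWithinAt) fun s hs => ?_
  rw [interior_Ici] at hs
  rw [(hd s).deriv]
  have := hanti Set.self_mem_Ici (Set.mem_Ici.2 (le_of_lt hs)) (le_of_lt hs)
  simp only [Real.sinh_zero, zero_mul, sub_zero] at this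
  exact mul_nonpos_of_nonpos_of_nonneg this (Real.exp_pos _).le

lemma cosh_le_exp_mul_cosh {s t : ℝ} (ht : 0 ≤ t) (hst : t ≤ s) :
    Real.cosh s ≤ Real.exp ((s ^ 2 - t ^ 2) / 2) * Real.cosh t := by
  have h := cosh_mul_exp_antitoneOn (Set.mem_Ici.2 ht) (Set.mem_Ici.2 (ht.trans hst)) hst
  simp only at h
  calc Real.cosh s = Real.cosh s * Real.exp (-(s ^ 2 / 2)) * Real.exp (s ^ 2 / 2) := by
        rw [mul_assoc, ← Real.exp_add]; simp
    _ ≤ Real.cosh t * Real.exp (-(t ^ 2 / 2)) * Real.exp (s ^ 2 / 2) := by gcongr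
    _ = _ := by
        rw [mul_assoc, ← Real.exp_add, mul_comm]
        congr 2
        ring

/-- The value at `1` of the chord of `x ↦ xᵃ` over `[exp (-ε), exp ε]`. -/
lemma chord_le {a ε : ℝ} (ha : 1 < a) (hε : 0 < ε) :
    ((Real.exp ε - 1) * Real.exp (-(a * ε)) + (1 - Real.exp (-ε)) * Real.exp (a * ε)) /
      (Real.exp ε - Real.exp (-ε)) ≤ Real.exp (a * (a - 1) * (ε ^ 2 / 2)) := by
  set t := ε / 2 with ht
  have ht0 : 0 < t := by positivity
  have hε' : ε = 2 * t := by rw [ht]; ring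
  -- With `ε = 2t` the quotient equals `cosh ((2a - 1) t) / cosh t`, after cancelling `exp t - exp
  -- (-t)`.
  have h := cosh_le_exp_mul_cosh (s := (2 * a - 1) * t) (t := t) ht0.le (by nlinarith)
  rw [show (((2 * a - 1) * t) ^ 2 - t ^ 2) / 2 = a * (a - 1) * (ε ^ 2 / 2) by rw [hε']; ring] at h
  have hden : 0 < Real.exp ε - Real.exp (-ε) := by
    rw [sub_pos, Real.exp_lt_exp]; linarith
  rw [div_le_iff₀ hden]
  have hs : 0 < Real.exp t - Real.exp (-t) := by
    rw [sub_pos, Real.exp_lt_exp]; linarith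
  rw [Real.cosh_eq, Real.cosh_eq] at h
  have e1 : Real.exp ε - Real.exp (-ε) =
      (Real.exp t - Real.exp (-t)) * (Real.exp t + Real.exp (-t)) := by
    ring_nf
    simp only [← Real.exp_nat_mul]
    rw [hε']
    push_cast
    ring_nf
  have e2 : (Real.exp ε - 1) * Real.exp (-(a * ε)) + (1 - Real.exp (-ε)) * Real.exp (a * ε) =
      (Real.exp t - Real.exp (-t)) *
        (Real.exp ((2 * a - 1) * t) + Real.exp (-((2 * a - 1) * t))) := by
    simp only [sub_mul, mul_add, one_mul, ← Real.exp_add]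
    rw [hε']
    ring_nf
  rw [e1, e2]
  nlinarith [mul_le_mul_of_nonneg_left h hs.le]

lemma rpow_le_chord {a u v x : ℝ} (ha : 1 ≤ a) (hu : 0 ≤ u) (huv : u < v) (hx : x ∈ Set.Icc u v) :
    x ^ a ≤ ((v - x) * u ^ a + (x - u) * v ^ a) / (v - u) := by
  have hvu : 0 < v - u := by linarith
  have := (convexOn_rpow ha).2 (Set.mem_Ici.2 hu) (Set.mem_Ici.2 (hu.trans huv.le))
    (div_nonneg (by linarith [hx.2] : 0 ≤ v - x) hvu.le)
    (div_nonneg (by linarith [hx.1] : 0 ≤ x - u) hvu.le) (by field_simp; ring)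
  simp only [smul_eq_mul] at this
  rw [show (v - x) / (v - u) * u + (x - u) / (v - u) * v = x by field_simp; ring] at this
  refine this.trans_eq ?_
  field_simp

/-- The density `g` lies in `[exp (-ε), exp ε]` and has mean `1`. By convexity `gᵃ` is below the
chord of `x ↦ xᵃ` over this interval, so its integral is at most the value of the chord at `1`. -/
lemma RenyiLE.of_pure {Ω : Type*} [MeasurableSpace Ω] {a ε : ℝ} (ha : 1 < a) (hε : 0 < ε)
    {μ ν : Measure Ω} [IsProbabilityMeasure μ] [IsProbabilityMeasure ν]
    (h₁ : μ ≤ ENNReal.ofReal (Real.exp ε) • ν) (h₂ : ν ≤ ENNReal.ofReal (Real.exp ε) • μ) :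
    RenyiLE a (ε ^ 2 / 2) μ ν := by
  have hac : μ ≪ ν := Measure.absolutelyContinuous_of_le_smul h₁
  set g := μ.rnDeriv ν with hg
  have hgm : Measurable g := Measure.measurable_rnDeriv μ ν
  have hμ : ν.withDensity g = μ := Measure.withDensity_rnDeriv_eq μ ν hac
  have hgi : ∀ s, MeasurableSet s → ∫⁻ x in s, g x ∂ν = μ s := fun s hs => by
    rw [← withDensity_apply _ hs, hμ]
  have hle : ∀ᵐ x ∂ν, g x ≤ ENNReal.ofReal (Real.exp ε) := by
    refine ae_le_of_forall_setLIntegral_le_of_sigmaFinite hgm fun s hs _ => ?_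
    rw [hgi s hs, setLIntegral_const]
    exact h₁ s
  have hge : ∀ᵐ x ∂ν, 1 ≤ ENNReal.ofReal (Real.exp ε) * g x := by
    refine ae_le_of_forall_setLIntegral_le_of_sigmaFinite measurable_const fun s hs _ => ?_
    rw [lintegral_const_mul _ hgm, hgi s hs, setLIntegral_one]
    exact h₂ s
  have hIcc : ∀ᵐ x ∂ν, (g x).toReal ∈ Set.Icc (Real.exp (-ε)) (Real.exp ε) ∧ g x ≠ ∞ := by
    filter_upwards [hle, hge] with x h1 h2
    have hfin : g x ≠ ∞ := ne_top_of_le_ne_top ENNReal.ofReal_ne_top h1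
    refine ⟨⟨?_, ENNReal.toReal_le_of_le_ofReal (Real.exp_pos _).le h1⟩, hfin⟩
    rw [← ENNReal.ofReal_toReal hfin, ← ENNReal.ofReal_mul (Real.exp_pos _).le,
      ENNReal.one_le_ofReal] at h2
    rw [Real.exp_neg, inv_le_iff_one_le_mul₀' (Real.exp_pos _)]
    exact h2
  have hint : Integrable (fun x => (g x).toReal) ν := Measure.integrable_toReal_rnDeriv
  have hint1 : ∫ x, (g x).toReal ∂ν = 1 := by
    rw [Measure.integral_toReal_rnDeriv hac]; simp
  have huv : Real.exp (-ε) < Real.exp ε := Real.exp_lt_exp.2 (by linarith)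
  have hden : 0 < Real.exp ε - Real.exp (-ε) := by linarith
  refine of_withDensity ha hgm hμ.symm ?_
  let c : ℝ → ℝ := fun x => ((Real.exp ε - x) * Real.exp (-ε) ^ a +
    (x - Real.exp (-ε)) * Real.exp ε ^ a) / (Real.exp ε - Real.exp (-ε))
  have hbound : ∫⁻ x, g x ^ a ∂ν ≤ ∫⁻ x, ENNReal.ofReal (c (g x).toReal) ∂ν := by
    refine lintegral_mono_ae ?_
    filter_upwards [hIcc] with x hx
    rw [← ENNReal.ofReal_toReal hx.2, ENNReal.ofReal_rpow_of_nonneg ENNReal.toReal_nonneg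
      (by linarith), ENNReal.toReal_ofReal ENNReal.toReal_nonneg]
    exact ENNReal.ofReal_le_ofReal (rpow_le_chord ha.le (Real.exp_pos _).le huv hx.1)
  have hcint : Integrable (fun x => c (g x).toReal) ν := by
    have hk := integrable_const (μ := ν) (1 : ℝ)
    refine (((((hk.const_mul (Real.exp ε)).sub hint).mul_const (Real.exp (-ε) ^ a)).add
      ((hint.sub (hk.const_mul (Real.exp (-ε)))).mul_const (Real.exp ε ^ a))).div_const
        (Real.exp ε - Real.exp (-ε))).congr (ae_of_all _ fun x => ?_)
    simp [c]
  have hcval : ∫ x, c (g x).toReal ∂ν = c 1 := by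
    have hk := integrable_const (μ := ν) (1 : ℝ)
    -- The chord is affine, so its integral is its value at the mean of `g`.
    have hA : ∀ x, c x = c 0 + x * (c 1 - c 0) := fun x => by simp only [c]; field_simp; ring
    simp_rw [hA (ENNReal.toReal _)]
    rw [integral_add (integrable_const _) (hint.mul_const _), integral_mul_const, hint1]
    simp
  have hcnn : 0 ≤ᵐ[ν] fun x => c (g x).toReal := by
    filter_upwards [hIcc] with x hx
    exact (Real.rpow_nonneg ENNReal.toReal_nonneg a).trans
      (rpow_le_chord ha.le (Real.exp_pos _).le huv hx.1)
  refine hbound.trans ?_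
  rw [← ofReal_integral_eq_lintegral_ofReal hcint hcnn, hcval]
  refine ENNReal.ofReal_le_ofReal (le_trans (le_of_eq ?_) (chord_le ha hε))
  simp only [c]
  rw [← Real.exp_mul, ← Real.exp_mul]
  ring_nf

end

section

/-! ### Laplace noise -/

def laplacePDF (b : ℝ≥0) (x : ℝ) : ℝ≥0∞ :=
  ENNReal.ofReal (1 / (2 * (b : ℝ)) * Real.exp (-|x| / b))

lemma measurable_laplacePDF (b : ℝ≥0) : Measurable (laplacePDF b) := by
  unfold laplacePDF
  fun_prop

lemma laplaceReal_of_ne_zero {b : ℝ≥0} (hb : b ≠ 0) :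
    laplaceReal b = volume.withDensity (laplacePDF b) := by
  rw [laplaceReal, if_neg hb]
  rfl

lemma lintegral_laplaceReal {b : ℝ≥0} (hb : b ≠ 0) {f : ℝ → ℝ≥0∞} (hf : Measurable f) :
    ∫⁻ x, f x ∂laplaceReal b = ∫⁻ x, laplacePDF b x * f x := by
  rw [laplaceReal_of_ne_zero hb,
    lintegral_withDensity_eq_lintegral_mul _ (measurable_laplacePDF b) hf]
  rfl

instance isProbabilityMeasure_laplaceReal (b : ℝ≥0) : IsProbabilityMeasure (laplaceReal b) := by
  by_cases hb : b = 0
  · rw [laplaceReal, if_pos hb]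
    infer_instance
  constructor
  have hb0 : (0 : ℝ) < b := by positivity
  have hneg : -(b : ℝ)⁻¹ < 0 := by simpa using hb0
  have hfun : (fun x : ℝ => 1 / (2 * (b : ℝ)) * Real.exp (-|x| / b)) =
      fun x => (fun y => 1 / (2 * (b : ℝ)) * Real.exp (-(b : ℝ)⁻¹ * y)) |x| := by
    ext x
    simp only
    congr 2
    field_simp
  have hval : ∫ x : ℝ, 1 / (2 * (b : ℝ)) * Real.exp (-|x| / b) = 1 := by
    rw [hfun, integral_comp_abs (f := fun y => 1 / (2 * (b : ℝ)) * Real.exp (-(b : ℝ)⁻¹ * y)),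
      integral_const_mul, integral_exp_mul_Ioi hneg]
    simp
    field_simp
  have hint : Integrable fun x : ℝ => 1 / (2 * (b : ℝ)) * Real.exp (-|x| / b) :=
    Integrable.of_integral_ne_zero (by rw [hval]; exact one_ne_zero)
  rw [laplaceReal_of_ne_zero hb, withDensity_apply _ MeasurableSet.univ, setLIntegral_univ]
  unfold laplacePDF
  rw [← ofReal_integral_eq_lintegral_ofReal hint (ae_of_all _ fun x => by positivity), hval,
    ENNReal.ofReal_one]

lemma laplaceReal_map_mul {b c : ℝ≥0} (hb : b ≠ 0) (hc : c ≠ 0) :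
    (laplaceReal b).map (fun x => (c : ℝ) * x) = laplaceReal (c * b) := by
  have hc0 : (0 : ℝ) < c := by positivity
  have hb0 : (0 : ℝ) < b := by positivity
  refine Measure.ext_of_lintegral _ fun f hf => ?_
  have hm : Measurable fun x => laplacePDF (c * b) x * f x := (measurable_laplacePDF _).mul hf
  have hvol : ∫⁻ x, laplacePDF (c * b) x * f x =
      ∫⁻ x, ENNReal.ofReal |(c : ℝ)| * (laplacePDF (c * b) (c * x) * f (c * x)) := by
    conv_lhs => rw [← Real.smul_map_volume_mul_left hc0.ne']
    rw [lintegral_smul_measure, lintegral_map hm (by fun_prop), smul_eq_mul]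
    exact (lintegral_const_mul _
      (hm.comp (by fun_prop : Measurable fun x : ℝ => (c : ℝ) * x))).symm
  rw [lintegral_map hf (by fun_prop), lintegral_laplaceReal hb (by fun_prop),
    lintegral_laplaceReal (mul_ne_zero hc hb) hf, hvol]
  refine lintegral_congr fun x => ?_
  rw [← mul_assoc, laplacePDF, laplacePDF, ← ENNReal.ofReal_mul (abs_nonneg _), abs_mul,
    abs_of_pos hc0]
  congr 2
  push_cast
  rw [← mul_assoc]
  congr 1
  · field_simp
  · congr 1
    field_simp

/-- After translating the right-hand integral by `s`, the densities are compared pointwise through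
`|x + s| ≤ |x| + |s|`. -/
lemma lintegral_laplaceReal_add_le {b : ℝ≥0} (hb : b ≠ 0) (s : ℝ) {f : ℝ → ℝ≥0∞}
    (hf : Measurable f) :
    ∫⁻ x, f (x + s) ∂laplaceReal b ≤
      ENNReal.ofReal (Real.exp (|s| / b)) * ∫⁻ x, f x ∂laplaceReal b := by
  have hb0 : (0 : ℝ) < b := by positivity
  have hp := measurable_laplacePDF b
  rw [lintegral_laplaceReal hb (by fun_prop), lintegral_laplaceReal hb hf,
    ← lintegral_const_mul _ (by fun_prop),
    ← lintegral_add_right_eq_self (fun x => _ * (laplacePDF b x * f x)) s]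
  refine lintegral_mono fun x => ?_
  simp only
  rw [← mul_assoc, laplacePDF, laplacePDF, ← ENNReal.ofReal_mul (Real.exp_pos _).le,
    mul_left_comm, ← Real.exp_add, ← add_div]
  gcongr
  linarith [abs_add_le x s]

variable {ι : Type} [Fintype ι]

instance isProbabilityMeasure_laplaceNoise (b : ℝ) : IsProbabilityMeasure (laplaceNoise ι b) := by
  unfold laplaceNoise
  infer_instance

lemma laplaceNoise_map_mul {b c : ℝ} (hb : 0 < b) (hc : 0 < c) :
    (laplaceNoise ι b).map (fun r i => c * r i) = laplaceNoise ι (c * b) := by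
  have hc' : c = (c.toNNReal : ℝ) := (Real.coe_toNNReal c hc.le).symm
  have h : ∀ _ : ι, (laplaceReal b.toNNReal).map (fun x => c * x) =
      laplaceReal (c * b).toNNReal := fun _ => by
    have := laplaceReal_map_mul (b := b.toNNReal) (c := c.toNNReal) (by simpa using hb)
      (by simpa using hc)
    rw [← hc'] at this
    rw [this, Real.toNNReal_mul hc.le]
  have : ∀ _ : ι, IsProbabilityMeasure ((laplaceReal b.toNNReal).map (fun x => c * x)) :=
    fun i => by rw [h i]; infer_instance
  unfold laplaceNoise
  rw [Measure.pi_map_pi (f := fun _ x => c * x) (fun _ => by fun_prop)]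
  congr 1
  exact funext h

/-- Only coordinate `k` moves; integrating it out first reduces the claim to one dimension. -/
lemma lintegral_laplaceNoise_update_le [DecidableEq ι] {b : ℝ} (hb : 0 < b) (k : ι) (s : ℝ)
    {f : (ι → ℝ) → ℝ≥0∞} (hf : Measurable f) :
    ∫⁻ r, f (Function.update r k (r k + s)) ∂laplaceNoise ι b ≤
      ENNReal.ofReal (Real.exp (|s| / b)) * ∫⁻ r, f r ∂laplaceNoise ι b := by
  have hS : Measurable fun r : ι → ℝ => Function.update r k (r k + s) := by fun_prop
  rw [← lintegral_const_mul _ hf]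
  refine lintegral_le_of_lmarginal_le {k} (hf.comp hS) (by fun_prop) fun r => ?_
  simp only [lmarginal_singleton, Function.update_self, Function.update_idem]
  have hu : Measurable fun x : ℝ => f (Function.update r k x) := by fun_prop
  have hb' : (b.toNNReal : ℝ) = b := Real.coe_toNNReal b hb.le
  have := lintegral_laplaceReal_add_le (b := b.toNNReal) (by simpa using hb) s hu
  rwa [hb', ← lintegral_const_mul _ hu] at this

/-! ### Report noisy min -/

variable [Nonempty ι] [LinearOrder ι]

lemma argminIndex_eq_iff (α : ι → ℝ) (k : ι) :
    argminIndex α = k ↔ (∀ j, α k ≤ α j) ∧ ∀ j < k, α k < α j := by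
  unfold argminIndex
  rw [Finset.min'_eq_iff]
  simp only [Finset.mem_filter, Finset.mem_univ, true_and]
  refine and_congr_right fun hk => ⟨fun h j hj => ?_, fun h j hj => ?_⟩
  · refine lt_of_not_ge fun hle => ?_
    exact absurd (h j fun i => hle.trans (hk i)) (not_le.2 hj)
  · refine le_of_not_gt fun hlt => ?_
    exact absurd (hj k) (not_le.2 (h j hlt))

lemma argminIndex_mul {c : ℝ} (hc : 0 < c) (α : ι → ℝ) :
    argminIndex (fun k => c * α k) = argminIndex α := by
  rw [argminIndex_eq_iff]
  have := (argminIndex_eq_iff α _).1 rfl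
  exact ⟨fun j => mul_le_mul_of_nonneg_left (this.1 j) hc.le,
    fun j hj => mul_lt_mul_of_pos_left (this.2 j hj) hc⟩

lemma measurable_argminIndex [MeasurableSpace ι] :
    Measurable (argminIndex : (ι → ℝ) → ι) := by
  refine measurable_to_countable' fun k => ?_
  have : argminIndex ⁻¹' {k} =
      {α : ι → ℝ | ∀ j, α k ≤ α j} ∩ {α : ι → ℝ | ∀ j, j < k → α k < α j} := by
    ext α
    simpa using argminIndex_eq_iff α k
  rw [this]
  refine MeasurableSet.inter ?_ ?_
  · rw [Set.ofPred_forall]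
    exact MeasurableSet.iInter fun j => measurableSet_le (by fun_prop) (by fun_prop)
  · rw [Set.ofPred_forall]
    refine MeasurableSet.iInter fun j => ?_
    rw [Set.ofPred_forall]
    exact MeasurableSet.iInter fun _ => measurableSet_lt (by fun_prop) (by fun_prop)

/-- The law of the index selected by report-noisy-min. -/
def noisyArgmin [MeasurableSpace ι] (q : ι → ℝ) (b : ℝ) : Measure ι :=
  (laplaceNoise ι b).map fun r => argminIndex fun k => q k + r k

variable [MeasurableSpace ι]

lemma measurable_argminIndex_add (q : ι → ℝ) :
    Measurable fun r : ι → ℝ => argminIndex fun k => q k + r k :=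
  measurable_argminIndex.comp (by fun_prop)

instance isProbabilityMeasure_noisyArgmin (q : ι → ℝ) (b : ℝ) :
    IsProbabilityMeasure (noisyArgmin q b) :=
  Measure.isProbabilityMeasure_map (measurable_argminIndex_add q).aemeasurable

/-- This removes the dependence of the noise scale on the number of records. -/
lemma noisyArgmin_mul (q : ι → ℝ) {b c : ℝ} (hb : 0 < b) (hc : 0 < c) :
    noisyArgmin (fun k => c * q k) (c * b) = noisyArgmin q b := by
  unfold noisyArgmin
  rw [← laplaceNoise_map_mul hb hc, Measure.map_map (measurable_argminIndex_add _) (by fun_prop)]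
  congr 1
  ext r : 1
  simp only [Function.comp, ← mul_add]
  exact argminIndex_mul hc _

/-- If `k` wins for `q`, it still wins for `q'` once its own noise is lowered by `2Δ`: one `Δ`
covers the change of its score, the other that of a competitor. Strict inequalities survive, so the
tie-breaking does too. Shifting one Laplace coordinate by `2Δ` costs `exp (2Δ / b)`, however many
candidates there are. -/
lemma noisyArgmin_singleton_le [MeasurableSingletonClass ι] {q q' : ι → ℝ} {b Δ : ℝ} (hb : 0 < b)
    (h : ∀ k, |q k - q' k| ≤ Δ) (k : ι) :
    noisyArgmin q b {k} ≤ ENNReal.ofReal (Real.exp (2 * Δ / b)) * noisyArgmin q' b {k} := by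
  have hΔ : 0 ≤ Δ := (abs_nonneg _).trans (h k)
  set E := (fun r : ι → ℝ => argminIndex fun j => q j + r j) ⁻¹' {k} with hE
  set E' := (fun r : ι → ℝ => argminIndex fun j => q' j + r j) ⁻¹' {k} with hE'
  have hEm : MeasurableSet E := measurable_argminIndex_add q (measurableSet_singleton k)
  have hEm' : MeasurableSet E' := measurable_argminIndex_add q' (measurableSet_singleton k)
  have hsub : ∀ r ∈ E, Function.update r k (r k + -(2 * Δ)) ∈ E' := by
    intro r hr
    have hr' := (argminIndex_eq_iff _ _).1 (show argminIndex (fun j => q j + r j) = k from hr)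
    refine (argminIndex_eq_iff _ _).2 ⟨fun j => ?_, fun j hj => ?_⟩
    · by_cases hjk : j = k
      · rw [hjk]
      · simp only [Function.update_self, Function.update_of_ne hjk]
        linarith [hr'.1 j, abs_le.1 (h k), abs_le.1 (h j)]
    · simp only [Function.update_self, Function.update_of_ne hj.ne]
      linarith [hr'.2 j hj, abs_le.1 (h k), abs_le.1 (h j)]
  rw [noisyArgmin, noisyArgmin,
    Measure.map_apply (measurable_argminIndex_add q) (measurableSet_singleton k),
    Measure.map_apply (measurable_argminIndex_add q') (measurableSet_singleton k),
    ← hE, ← hE', ← lintegral_indicator_one hEm, ← lintegral_indicator_one hEm']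
  have := lintegral_laplaceNoise_update_le hb k (-(2 * Δ))
    ((measurable_one (α := ℝ≥0∞)).indicator hEm')
  rw [abs_neg, abs_of_nonneg (by positivity)] at this
  refine le_trans (lintegral_mono fun r => ?_) this
  by_cases hr : r ∈ E
  · rw [Set.indicator_of_mem hr, Set.indicator_of_mem (hsub r hr)]
    exact le_rfl
  · rw [Set.indicator_of_notMem hr]
    exact zero_le

lemma noisyArgmin_le [MeasurableSingletonClass ι] {q q' : ι → ℝ} {b Δ : ℝ} (hb : 0 < b)
    (h : ∀ k, |q k - q' k| ≤ Δ) :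
    noisyArgmin q b ≤ ENNReal.ofReal (Real.exp (2 * Δ / b)) • noisyArgmin q' b := by
  refine Measure.le_iff.2 fun s hs => ?_
  rw [← lintegral_indicator_one hs, ← lintegral_indicator_one hs, lintegral_fintype,
    lintegral_fintype]
  refine Finset.sum_le_sum fun k _ => ?_
  exact mul_le_mul' le_rfl (noisyArgmin_singleton_le hb h k)

lemma RenyiLE.noisyArgmin [MeasurableSingletonClass ι] {q q' : ι → ℝ} {a b Δ : ℝ} (ha : 1 < a)
    (hb : 0 < b) (hΔ : 0 < Δ) (h : ∀ k, |q k - q' k| ≤ Δ) :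
    RenyiLE a ((2 * Δ / b) ^ 2 / 2) (noisyArgmin q b) (noisyArgmin q' b) :=
  RenyiLE.of_pure ha (by positivity) (noisyArgmin_le hb h)
    (noisyArgmin_le hb fun k => by rw [abs_sub_comm]; exact h k)

end

section

/-! ### Gaussian noise -/

lemma RenyiLE.gaussianReal {a : ℝ} (ha : 1 < a) (m m' : ℝ) {v : ℝ≥0} (hv : v ≠ 0) :
    RenyiLE a ((m - m') ^ 2 / (2 * v)) (gaussianReal m v) (gaussianReal m' v) := by
  have hv0 : (0 : ℝ) < v := by positivity
  -- With equal variances the log-density ratio is affine in `x`, with slope `t` and intercept `s`;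
  -- its exponential moments come from the Gaussian moment generating function.
  set t := (m - m') / v with ht
  set s := (m' ^ 2 - m ^ 2) / (2 * v) with hs
  refine of_withDensity ha (g := fun x => ENNReal.ofReal (Real.exp (t * x + s))) (by fun_prop) ?_ ?_
  · rw [gaussianReal_of_var_ne_zero _ hv, gaussianReal_of_var_ne_zero _ hv,
      ← withDensity_mul _ (measurable_gaussianPDF _ _) (by fun_prop)]
    congr 1
    ext x
    simp only [Pi.mul_apply, gaussianPDF, gaussianPDFReal]
    rw [← ENNReal.ofReal_mul (by positivity), mul_assoc _ (Real.exp _), ← Real.exp_add]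
    congr 3
    rw [ht, hs]
    field_simp
    ring
  · have hfun : (fun x : ℝ => ENNReal.ofReal (Real.exp (t * x + s)) ^ a) =
        fun x => ENNReal.ofReal (Real.exp (a * s) * Real.exp ((a * t) * x)) := by
      ext x
      rw [ENNReal.ofReal_rpow_of_pos (Real.exp_pos _), ← Real.exp_mul, ← Real.exp_add]
      congr 2
      ring
    rw [hfun, ← ofReal_integral_eq_lintegral_ofReal
      ((integrable_exp_mul_gaussianReal _).const_mul _) (ae_of_all _ fun x => by positivity),
      integral_const_mul]
    have hm := mgf_gaussianReal (p := ProbabilityTheory.gaussianReal m' v) (X := id)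
      Measure.map_id (a * t)
    simp only [mgf, id] at hm
    rw [hm, ← Real.exp_add]
    refine ENNReal.ofReal_le_ofReal (Real.exp_le_exp.2 (le_of_eq ?_))
    rw [ht, hs]
    field_simp
    ring

/-- Induction on the dimension: splitting off a coordinate is a composition whose second stage
ignores the first. -/
lemma RenyiLE.pi_gaussianReal {a : ℝ} (ha : 1 < a) {v : ℝ≥0} (hv : v ≠ 0) :
    ∀ {d : ℕ} (m m' : Fin d → ℝ), RenyiLE a ((∑ i, (m i - m' i) ^ 2) / (2 * v))
      (Measure.pi fun i => ProbabilityTheory.gaussianReal (m i) v)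
      (Measure.pi fun i => ProbabilityTheory.gaussianReal (m' i) v)
  | 0, m, m' => by
    rw [Subsingleton.elim m m']
    simpa using RenyiLE.refl ha (Measure.pi fun i => ProbabilityTheory.gaussianReal (m' i) v)
  | d + 1, m, m' => by
    have ih := RenyiLE.pi_gaussianReal ha hv (fun i => m i.succ) (fun i => m' i.succ)
    let e := MeasurableEquiv.piFinSuccAbove (fun _ : Fin (d + 1) => ℝ) 0
    have hpi : ∀ m : Fin (d + 1) → ℝ,
        Measure.pi (fun i => ProbabilityTheory.gaussianReal (m i) v) =
        ((ProbabilityTheory.gaussianReal (m 0) v).prod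
          (Measure.pi fun i => ProbabilityTheory.gaussianReal (m (Fin.succ i)) v)).map e.symm :=
      fun m => by
        rw [← (measurePreserving_piFinSuccAbove
          (fun i => ProbabilityTheory.gaussianReal (m i) v) 0).symm.map_eq]
        rfl
    rw [hpi, hpi, Fin.sum_univ_succ, add_div]
    exact RenyiLE.comp ha e.symm.measurable e.symm.measurable (RenyiLE.gaussianReal ha _ _ hv)
      (ae_of_all _ fun x => ih.map (e.symm.measurable.comp measurable_prodMk_left))

variable {d : ℕ}

instance isProbabilityMeasure_gaussianNoise (v : ℝ) :
    IsProbabilityMeasure (gaussianNoise d v) := by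
  unfold gaussianNoise
  infer_instance

lemma gaussianNoise_map_add (v : ℝ) (m : Fin d → ℝ) :
    (gaussianNoise d v).map (fun g i => m i + g i) =
      Measure.pi fun i => gaussianReal (m i) v.toNNReal := by
  have h : ∀ i, (gaussianReal 0 v.toNNReal).map (fun x => m i + x) =
      gaussianReal (m i) v.toNNReal := fun i => by
    rw [gaussianReal_map_const_add, zero_add]
  have : ∀ i, IsProbabilityMeasure ((gaussianReal 0 v.toNNReal).map (fun x => m i + x)) :=
    fun i => by rw [h i]; infer_instance
  unfold gaussianNoise
  rw [Measure.pi_map_pi (f := fun i x => m i + x) (fun _ => by fun_prop)]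
  simp_rw [h]

/-- The Gaussian mechanism, including the noiseless case of a query of sensitivity `0`. -/
lemma RenyiLE.gaussianNoise {a v Δ : ℝ} (ha : 1 < a) {m m' : EuclideanSpace ℝ (Fin d)}
    (hv : 0 < v ∨ Δ = 0) (h : ‖m - m'‖ ≤ Δ) :
    RenyiLE a (Δ ^ 2 / (2 * v))
      ((gaussianNoise d v).map fun g => m + WithLp.toLp 2 g)
      ((gaussianNoise d v).map fun g => m' + WithLp.toLp 2 g) := by
  have hmeas : ∀ m : EuclideanSpace ℝ (Fin d),
      Measurable fun g : Fin d → ℝ => m + WithLp.toLp 2 g := fun m => by fun_prop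
  rcases hv with hv | rfl
  · have hto : Measurable (WithLp.toLp 2 : (Fin d → ℝ) → EuclideanSpace ℝ (Fin d)) := by fun_prop
    have key := (RenyiLE.pi_gaussianReal ha (v := v.toNNReal) (by simpa using hv) m.ofLp m'.ofLp)
    rw [← gaussianNoise_map_add, ← gaussianNoise_map_add] at key
    have key' := key.map hto
    rw [Measure.map_map hto (by fun_prop), Measure.map_map hto (by fun_prop)] at key'
    refine RenyiLE.mono ha key' ?_
    rw [Real.coe_toNNReal v hv.le]
    gcongr
    have hn := EuclideanSpace.norm_sq_eq (m - m')
    simp only [PiLp.sub_apply, Real.norm_eq_abs, sq_abs] at hn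
    rw [← hn]
    gcongr
  · have : m = m' := sub_eq_zero.1 (norm_le_zero_iff.1 h)
    subst this
    have := Measure.isProbabilityMeasure_map (μ := ADPScreen.gaussianNoise d v)
      (hmeas m).aemeasurable
    simpa using RenyiLE.refl ha (Measure.map _ (ADPScreen.gaussianNoise d v))

end

section

/-! ### Measurability of the screening vector -/

namespace Dataset

variable {d : ℕ} (D : Dataset d)

lemma predict_apply (w : EuclideanSpace ℝ (Fin d)) (i : Fin D.n) :
    D.predict w i = ∑ j, D.X i j * w j := rfl

@[fun_prop]
lemma continuous_predict : Continuous D.predict := by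
  unfold predict
  fun_prop

lemma contDiff_loss : ContDiff ℝ 1 D.loss := by
  unfold loss
  fun_prop

@[fun_prop]
lemma continuous_gradAt : Continuous D.gradAt := by
  have h : Continuous (gradient D.loss) :=
    (InnerProductSpace.toDual ℝ _).symm.continuous.comp
      (D.contDiff_loss.continuous_fderiv one_ne_zero)
  exact h.comp D.continuous_predict

lemma isCompact_l1Ball (lam : ℝ) : IsCompact (l1Ball d lam) := by
  refine Metric.isCompact_of_isClosed_isBounded ?_ ?_
  · exact isClosed_le (by fun_prop) continuous_const
  · refine (Metric.isBounded_closedBall (x := 0) (r := lam)).subset fun w hw => ?_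
    rw [mem_closedBall_zero_iff, EuclideanSpace.norm_eq]
    refine le_trans ?_ hw
    rw [Real.sqrt_le_left (Finset.sum_nonneg fun _ _ => abs_nonneg _)]
    simp only [Real.norm_eq_abs]
    exact Finset.sum_sq_le_sq_sum_of_nonneg fun _ _ => abs_nonneg _

@[fun_prop]
-- A supremum of continuous functions is lower semicontinuous; compactness of the ball makes it
-- finite.
lemma measurable_wolfeGap (lam : ℝ) : Measurable (D.wolfeGap lam) := by
  refine LowerSemicontinuous.measurable (lowerSemicontinuous_ciSup (fun w => ?_) fun z =>
    Continuous.lowerSemicontinuous ?_)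
  · have hc : Continuous fun z => inner ℝ (D.predict w - D.predict z) (D.gradAt w) := by fun_prop
    refine ((isCompact_l1Ball lam).bddAbove_image hc.continuousOn).mono ?_
    rintro _ ⟨z, rfl⟩
    exact ⟨z, z.2, rfl⟩
  · fun_prop

@[fun_prop]
lemma measurable_screenVector (lam : ℝ) : Measurable (D.screenVector lam) := by
  have h1 : ∀ i, Measurable fun w => inner ℝ (D.column i) (D.gradAt w) := fun i =>
    Continuous.measurable (by fun_prop)
  have h2 : Measurable fun w => inner ℝ (D.predict w) (D.gradAt w) :=
    Continuous.measurable (by fun_prop)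
  have h3 : Measurable fun w => ‖D.predict w‖ := Continuous.measurable (by fun_prop)
  unfold screenVector
  fun_prop

/-! ### Sensitivity of the gradient -/

/-- The factor `n` cancels the averaging, leaving one summand per record. -/
lemma card_mul_inner_gradient_objective (hn : 0 < D.n) (v w : EuclideanSpace ℝ (Fin d)) :
    (D.n : ℝ) * inner ℝ v (gradient D.objective w) =
      ∑ i, -(2 * (D.y i - ∑ j, D.X i j * w j) * ∑ j, D.X i j * v j) := by
  let ℓ : Fin D.n → EuclideanSpace ℝ (Fin d) →L[ℝ] ℝ := fun i =>
    ∑ j, D.X i j • EuclideanSpace.proj j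
  have hℓ : ∀ i u, ℓ i u = ∑ j, D.X i j * u j := fun i u => by simp [ℓ]
  have hobj : D.objective = fun w => 1 / (D.n : ℝ) * ∑ i, (D.y i - ℓ i w) ^ 2 := by
    ext w
    simp only [objective, loss, predict_apply, hℓ]
  have hd : HasFDerivAt D.objective ((1 / (D.n : ℝ)) • ∑ i,
      (2 * (D.y i - ℓ i w)) • (-(ℓ i))) w := by
    rw [hobj]
    refine HasFDerivAt.const_mul (HasFDerivAt.fun_sum fun i _ => ?_) _
    refine (((ℓ i).hasFDerivAt.const_sub (D.y i)).pow 2).congr_fderiv ?_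
    simp
  rw [inner_gradient_right, hd.fderiv]
  have hn' : (D.n : ℝ) ≠ 0 := by positivity
  simp [hℓ, hn']

@[fun_prop]
lemma continuous_gradient_objective : Continuous (gradient D.objective) := by
  have h : ContDiff ℝ 1 D.objective := by
    change ContDiff ℝ 1 fun w : EuclideanSpace ℝ (Fin d) =>
      1 / (D.n : ℝ) * ∑ i, (D.y i - ∑ j, D.X i j * w j) ^ 2
    fun_prop
  exact (InnerProductSpace.toDual ℝ _).symm.continuous.comp (h.continuous_fderiv one_ne_zero)

end Dataset

variable {d : ℕ}

lemma abs_sum_mul_le {x : Fin d → ℝ} (hx : ∀ j, |x j| ≤ 1) {lam : ℝ}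
    {w : EuclideanSpace ℝ (Fin d)} (hw : w ∈ l1Ball d lam) : |∑ j, x j * w j| ≤ lam := by
  refine (Finset.abs_sum_le_sum_abs _ _).trans (le_trans (Finset.sum_le_sum fun j _ => ?_) hw)
  rw [abs_mul]
  exact mul_le_of_le_one_left (abs_nonneg _) (hx j)

lemma RemovesOne.abs_sub_le {D D' : Dataset d} (h : RemovesOne D D') {lam : ℝ}
    (hD : Admissible lam D) (hD' : Admissible lam D') {v w : EuclideanSpace ℝ (Fin d)}
    (hv : v ∈ l1Ball d lam) (hw : w ∈ l1Ball d lam) :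
    |(D.n : ℝ) * inner ℝ v (gradient D.objective w) -
      (D'.n : ℝ) * inner ℝ v (gradient D'.objective w)| ≤ 4 * lam ^ 2 := by
  rw [D.card_mul_inner_gradient_objective hD.1, D'.card_mul_inner_gradient_objective hD'.1]
  obtain ⟨n, X, y, i, rfl, rfl⟩ := h
  rw [Fin.sum_univ_succAbove _ i]
  refine (congrArg abs (add_sub_cancel_right _ _)).trans_le ?_
  have hx : |∑ j, X i j * w j| ≤ lam := abs_sum_mul_le (hD.2.1 i) hw
  have hx' : |∑ j, X i j * v j| ≤ lam := abs_sum_mul_le (hD.2.1 i) hv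
  have hy : |y i| < lam := hD.2.2 i
  have hlam : 0 ≤ lam := (abs_nonneg _).trans hx
  rw [abs_neg, abs_mul, abs_mul, abs_two]
  -- The single summand of the removed record is all that remains.
  calc 2 * |y i - ∑ j, X i j * w j| * |∑ j, X i j * v j| ≤ 2 * (lam + lam) * lam := by
        gcongr
        exact (abs_sub _ _).trans (add_le_add hy.le hx)
    _ = 4 * lam ^ 2 := by ring

lemma Adjacent.abs_sub_le {D D' : Dataset d} (h : Adjacent D D') {lam : ℝ}
    (hD : Admissible lam D) (hD' : Admissible lam D') {v w : EuclideanSpace ℝ (Fin d)}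
    (hv : v ∈ l1Ball d lam) (hw : w ∈ l1Ball d lam) :
    |(D.n : ℝ) * inner ℝ v (gradient D.objective w) -
      (D'.n : ℝ) * inner ℝ v (gradient D'.objective w)| ≤ 4 * lam ^ 2 := by
  rcases h with h | h
  · exact h.abs_sub_le hD hD' hv hw
  · rw [abs_sub_comm]
    exact h.abs_sub_le hD' hD hv hw

/-! ### One iteration -/

lemma vertexPoint_mem {lam : ℝ} (hlam : 0 ≤ lam) (k : Vertex d) :
    vertexPoint lam k ∈ l1Ball d lam := by
  refine le_of_eq (?_ : ∑ j, |vertexPoint lam k j| = lam)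
  unfold vertexPoint
  rw [Finset.sum_eq_single (ofLex k).1]
  · split_ifs <;> simp [abs_of_nonneg hlam]
  · intro j _ hj
    simp [hj]
  · simp

/-- The Frank-Wolfe update towards the vertex `k`. -/
def moveTo (lam η : ℝ) (w : EuclideanSpace ℝ (Fin d)) (k : Vertex d) : EuclideanSpace ℝ (Fin d) :=
  (1 - η) • w + η • vertexPoint lam k

lemma moveTo_mem {lam η : ℝ} (hlam : 0 ≤ lam) (hη : 0 ≤ η ∧ η ≤ 1)
    {w : EuclideanSpace ℝ (Fin d)} (hw : w ∈ l1Ball d lam) (k : Vertex d) :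
    moveTo lam η w k ∈ l1Ball d lam := by
  have hv : ∑ j, |vertexPoint lam k j| ≤ lam := vertexPoint_mem hlam k
  have hw' : ∑ j, |w j| ≤ lam := hw
  have h1 : 0 ≤ 1 - η := by linarith [hη.2]
  calc ∑ j, |moveTo lam η w k j| ≤ ∑ j, ((1 - η) * |w j| + η * |vertexPoint lam k j|) := by
        refine Finset.sum_le_sum fun j _ => (abs_add_le _ _).trans_eq ?_
        simp [abs_mul, abs_of_nonneg hη.1, abs_of_nonneg h1]
    _ = (1 - η) * ∑ j, |w j| + η * ∑ j, |vertexPoint lam k j| := by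
        rw [Finset.sum_add_distrib, Finset.mul_sum, Finset.mul_sum]
    _ ≤ (1 - η) * lam + η * lam := by
        have := hη.1
        gcongr
    _ = lam := by ring

lemma zeroOut_mem {lam : ℝ} {w : EuclideanSpace ℝ (Fin d)} (hw : w ∈ l1Ball d lam)
    (s : EuclideanSpace ℝ (Fin d)) : zeroOut s w ∈ l1Ball d lam := by
  have hw' : ∑ j, |w j| ≤ lam := hw
  refine le_trans (Finset.sum_le_sum fun j _ => ?_) hw'
  by_cases h : s j < 0 <;> simp [zeroOut, h]

@[fun_prop]
lemma measurable_zeroOut : Measurable fun x : EuclideanSpace ℝ (Fin d) × EuclideanSpace ℝ (Fin d) =>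
    zeroOut x.1 x.2 := by
  have h : Measurable fun x : EuclideanSpace ℝ (Fin d) × EuclideanSpace ℝ (Fin d) =>
      fun j => if x.1 j < 0 then 0 else x.2 j := by
    refine measurable_pi_lambda _ fun j => Measurable.ite ?_ measurable_const (by fun_prop)
    exact measurableSet_lt (by fun_prop) measurable_const
  exact (by fun_prop : Measurable (WithLp.toLp 2 : (Fin d → ℝ) → EuclideanSpace ℝ (Fin d))).comp h

/-- The screening step of iteration `t`, with the Gaussian noise `g`. -/
def screen (p : Params d) (D : Dataset d) (t : ℕ) (w : EuclideanSpace ℝ (Fin d)) (g : Fin d → ℝ) :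
    EuclideanSpace ℝ (Fin d) :=
  if t ∈ p.I then zeroOut (D.screenVector p.lam w + WithLp.toLp 2 g) w else w

lemma measurable_screen (p : Params d) (D : Dataset d) (t : ℕ) :
    Measurable fun x : EuclideanSpace ℝ (Fin d) × (Fin d → ℝ) => screen p D t x.1 x.2 := by
  unfold screen
  split_ifs
  · exact measurable_zeroOut.comp (f := fun x : EuclideanSpace ℝ (Fin d) × (Fin d → ℝ) =>
      (D.screenVector p.lam x.1 + WithLp.toLp 2 x.2, x.1)) (by fun_prop)
  · exact measurable_fst

lemma screen_mem (p : Params d) (D : Dataset d) (t : ℕ) {w : EuclideanSpace ℝ (Fin d)}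
    (hw : w ∈ l1Ball d p.lam) (g : Fin d → ℝ) : screen p D t w g ∈ l1Ball d p.lam := by
  unfold screen
  split_ifs
  · exact zeroOut_mem hw _
  · exact hw

instance vertexMeasurableSpace : MeasurableSpace (Vertex d) := ⊤

instance vertexDiscreteMeasurableSpace : DiscreteMeasurableSpace (Vertex d) := ⟨fun _ => trivial⟩

lemma measurable_moveTo (lam η : ℝ) :
    Measurable fun x : EuclideanSpace ℝ (Fin d) × Vertex d => moveTo lam η x.1 x.2 := by
  have h : Measurable (vertexPoint lam : Vertex d → _) := Measurable.of_discrete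
  unfold moveTo
  fun_prop

/-- The scores of the vertices, before the noise is added. -/
def score (D : Dataset d) (lam : ℝ) (w : EuclideanSpace ℝ (Fin d)) (k : Vertex d) : ℝ :=
  inner ℝ (vertexPoint lam k) (gradient D.objective w)

lemma measurable_score (D : Dataset d) (lam : ℝ) (k : Vertex d) :
    Measurable fun w => score D lam w k := by
  unfold score
  exact Continuous.measurable (by fun_prop)

lemma measurable_screen_moveTo (p : Params d) (D : Dataset d) (t : ℕ)
    (w : EuclideanSpace ℝ (Fin d)) :
    Measurable fun x : Vertex d × (Fin d → ℝ) =>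
      screen p D t (moveTo p.lam (p.stepSize t) w x.1) x.2 := by
  have h1 : Measurable fun x : Vertex d × (Fin d → ℝ) => moveTo p.lam (p.stepSize t) w x.1 :=
    (measurable_moveTo p.lam (p.stepSize t)).comp (measurable_const.prodMk measurable_fst)
  have h2 := (measurable_screen p D t).comp (h1.prodMk measurable_snd)
  exact h2

variable [NeZero d]

lemma iteration_eq (p : Params d) (D : Dataset d) (t : ℕ) (w : EuclideanSpace ℝ (Fin d))
    (r : Vertex d → ℝ) (g : Fin d → ℝ) :
    iteration p D t w r g = screen p D t (moveTo p.lam (p.stepSize t) w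
      (argminIndex fun k => score D p.lam w k + r k)) g := rfl

lemma iteration_mem (p : Params d) (D : Dataset d) (t : ℕ) (hlam : 0 ≤ p.lam)
    (hη : 0 ≤ p.stepSize t ∧ p.stepSize t ≤ 1) {w : EuclideanSpace ℝ (Fin d)}
    (hw : w ∈ l1Ball d p.lam) (r : Vertex d → ℝ) (g : Fin d → ℝ) :
    iteration p D t w r g ∈ l1Ball d p.lam :=
  screen_mem p D t (moveTo_mem hlam hη hw _) g

lemma measurable_iteration (p : Params d) (D : Dataset d) (t : ℕ) :
    Measurable fun ω : EuclideanSpace ℝ (Fin d) × (Vertex d → ℝ) × (Fin d → ℝ) =>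
      iteration p D t ω.1 ω.2.1 ω.2.2 := by
  have h1 : Measurable fun ω : EuclideanSpace ℝ (Fin d) × (Vertex d → ℝ) × (Fin d → ℝ) =>
      argminIndex fun k => score D p.lam ω.1 k + ω.2.1 k :=
    measurable_argminIndex.comp (measurable_pi_lambda _ fun k => by
      have := measurable_score D p.lam k
      fun_prop)
  have h2 : Measurable fun ω : EuclideanSpace ℝ (Fin d) × (Vertex d → ℝ) × (Fin d → ℝ) =>
      moveTo p.lam (p.stepSize t) ω.1 (argminIndex fun k => score D p.lam ω.1 k + ω.2.1 k) :=
    (measurable_moveTo p.lam (p.stepSize t)).comp (measurable_fst.prodMk h1)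
  have h3 : Measurable fun ω : EuclideanSpace ℝ (Fin d) × (Vertex d → ℝ) × (Fin d → ℝ) =>
      ω.2.2 := measurable_snd.comp measurable_snd
  have h4 := (measurable_screen p D t).comp (h2.prodMk h3)
  refine (congrArg Measurable ?_).mpr h4
  funext ω
  exact iteration_eq p D t ω.1 ω.2.1 ω.2.2

end

section

variable {d : ℕ}

/-! ### Calibration of the noise -/

/-- The conversion cost `a ρ + L / (a - 1)` is least at `a = 1 + √(L / ρ)`, where it is `ρ + 2√(ρ
L)`. Subadditivity of the square root then separates `A` from `B`. -/
lemma exists_order {A B ε₁ ε₂ δ L₁ L₂ : ℝ} (hA : 0 < A) (hB : 0 ≤ B) (hδ : 0 < δ) (hδ1 : δ < 1)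
    (hL₁ : Real.log (1 / δ) ≤ L₁) (hL₂ : Real.log (1 / δ) ≤ L₂)
    (h₁ : A + 2 * √(A * L₁) ≤ ε₁) (h₂ : B + 2 * √(B * L₂) ≤ ε₂) :
    ∃ a : ℝ, 1 < a ∧ a * (A + B) + Real.log (1 / δ) / (a - 1) ≤ ε₁ + ε₂ := by
  set L := Real.log (1 / δ) with hL
  have hL0 : 0 < L := Real.log_pos (by rw [one_lt_div hδ]; exact hδ1)
  set ρ := A + B with hρ
  have hρ0 : 0 < ρ := by positivity
  have hr : 0 < √ρ := Real.sqrt_pos.2 hρ0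
  have hl : 0 < √L := Real.sqrt_pos.2 hL0
  refine ⟨1 + √L / √ρ, by have : 0 < √L / √ρ := by positivity
                          linarith, ?_⟩
  have e1 : (1 + √L / √ρ) * ρ + L / (1 + √L / √ρ - 1) = ρ + 2 * √(ρ * L) := by
    rw [Real.sqrt_mul hρ0.le, add_sub_cancel_left]
    have hρs : ρ = √ρ * √ρ := (Real.mul_self_sqrt hρ0.le).symm
    have hLs : L = √L * √L := (Real.mul_self_sqrt hL0.le).symm
    generalize √ρ = r at *
    generalize √L = l at *
    rw [hρs, hLs]
    field_simp
    ring
  have e2 : √(ρ * L) ≤ √(A * L₁) + √(B * L₂) := by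
    have hx : √(ρ * L) ≤ √(A * L₁ + B * L₂) := by
      apply Real.sqrt_le_sqrt
      rw [hρ, add_mul]
      gcongr
    refine hx.trans ?_
    rw [Real.sqrt_le_left (by positivity)]
    have p1 : 0 ≤ A * L₁ := mul_nonneg hA.le (hL0.le.trans hL₁)
    have p2 : 0 ≤ B * L₂ := mul_nonneg hB (hL0.le.trans hL₂)
    nlinarith [Real.sq_sqrt p1, Real.sq_sqrt p2, Real.sqrt_nonneg (A * L₁),
      Real.sqrt_nonneg (B * L₂)]
  rw [e1]
  linarith

lemma laplace_calibration {ε L : ℝ} (hε : 0 < ε) (hL : 0 < L) (hreg : ε ≤ 8 * L) :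
    ε ^ 2 / (16 * L) + 2 * √(ε ^ 2 / (16 * L) * L) ≤ ε := by
  have h : ε ^ 2 / (16 * L) * L = (ε / 4) ^ 2 := by field_simp; norm_num
  rw [h, Real.sqrt_sq (by positivity)]
  have : ε ^ 2 / (16 * L) ≤ ε / 2 := by
    rw [div_le_div_iff₀ (by positivity) (by norm_num)]
    nlinarith
  linarith

/-- Each of the two terms is at most `ε / 2`: the first by `hreg`, the second by `M ≥ 1 / 2` alone.
-/
lemma gaussian_calibration {ε L M : ℝ} (hε : 0 < ε) (hL : 0 < L) (hM : 1 / 2 ≤ M)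
    (hreg : ε ≤ 8 * L) :
    ε ^ 2 / (32 * L * M) + 2 * √(ε ^ 2 / (32 * L * M) * L) ≤ ε := by
  have h1 : ε ^ 2 / (32 * L * M) ≤ ε / 2 := by
    rw [div_le_div_iff₀ (by positivity) (by norm_num)]
    nlinarith [mul_le_mul_of_nonneg_left hM (by positivity : 0 ≤ 32 * L * ε)]
  have h2 : √(ε ^ 2 / (32 * L * M) * L) ≤ ε / 4 := by
    rw [Real.sqrt_le_left (by positivity)]
    rw [show ε ^ 2 / (32 * L * M) * L = ε ^ 2 / (32 * M) by field_simp, div_pow]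
    gcongr
    linarith
  linarith

namespace Params

variable {p : Params d}

/-- The scale of the Laplace noise for the unnormalised gradient of the objective. -/
def fwBudget (p : Params d) : ℝ :=
  4 * p.lam * (2 * p.lam) * √(8 * (p.T : ℝ) * Real.log (1 / p.δ₁)) / p.ε₁

lemma mul_fwScale (p : Params d) {n : ℕ} (hn : 0 < n) : n * p.fwScale n = p.fwBudget := by
  have : (n : ℝ) ≠ 0 := by positivity
  unfold fwScale fwBudget
  field_simp

lemma fwBudget_pos (hε : 0 < p.ε₁) (hL : 0 < Real.log (1 / p.δ₁)) (hlam : 0 < p.lam)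
    (hT : 0 < p.T) : 0 < p.fwBudget := by
  have : (0 : ℝ) < p.T := by exact_mod_cast hT
  unfold fwBudget
  positivity

/-- The pure privacy parameter of one step, `8 lam² / fwBudget`, is `ε₁ / √(8 T log(1/δ₁))`. -/
lemma T_mul_le (hε : 0 < p.ε₁) (hL : 0 < Real.log (1 / p.δ₁)) (hlam : 0 < p.lam) :
    p.T * ((2 * (4 * p.lam ^ 2) / p.fwBudget) ^ 2 / 2) ≤
      p.ε₁ ^ 2 / (16 * Real.log (1 / p.δ₁)) := by
  rcases Nat.eq_zero_or_pos p.T with hT | hT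
  · rw [hT]
    simp only [Nat.cast_zero, zero_mul]
    positivity
  · have hT' : (0 : ℝ) < p.T := by exact_mod_cast hT
    have hsq : √(8 * (p.T : ℝ) * Real.log (1 / p.δ₁)) ^ 2 = 8 * p.T * Real.log (1 / p.δ₁) :=
      Real.sq_sqrt (by positivity)
    refine le_of_eq ?_
    unfold fwBudget
    rw [div_pow, div_pow, mul_pow _ (√_), hsq]
    field_simp
    norm_num

lemma log_one_div_δiter_pos (hδ : 0 < p.δ₂ ∧ p.δ₂ < 1) : 0 < Real.log (1 / p.δiter) := by
  have h1 := hδ.1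
  have hpos : 0 < p.δiter := by
    unfold δiter
    positivity
  refine Real.log_pos ?_
  rw [one_lt_div hpos, δiter, div_lt_one (by positivity)]
  have : (0 : ℝ) ≤ p.l := by positivity
  linarith [hδ.2]

lemma log_one_div_le_δiter (hδ : 0 < p.δ₂) :
    Real.log (1 / p.δ₂) ≤ Real.log (1 / p.δiter) := by
  have hpos : 0 < p.δiter := by
    unfold δiter
    positivity
  refine Real.log_le_log (by positivity) (one_div_le_one_div_of_le hpos ?_)
  unfold δiter
  exact div_le_self hδ.le (by linarith [(by positivity : (0 : ℝ) ≤ p.l)])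

/-- One screening already forces `δiter ≤ 1 / 2`, and `log 2 > 1 / 2`. -/
lemma half_le_log_div_δiter (hδ : 0 < p.δ₂ ∧ p.δ₂ < 1) (hl : 0 < p.l) :
    1 / 2 ≤ Real.log (1.25 / p.δiter) := by
  have h1 := hδ.1
  have hpos : 0 < p.δiter := by
    unfold δiter
    positivity
  have hl' : (1 : ℝ) ≤ p.l := by exact_mod_cast hl
  have hle : p.δiter ≤ 1 / 2 := by
    unfold δiter
    rw [div_le_div_iff₀ (by positivity) (by norm_num)]
    linarith [hδ.2]
  have h3 : (2 : ℝ) ≤ 1.25 / p.δiter := by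
    rw [le_div_iff₀ hpos]
    linarith
  have := Real.log_le_log (by norm_num) h3
  linarith [Real.log_two_gt_d9]

lemma variance_pos (hδ : 0 < p.δ₂ ∧ p.δ₂ < 1) (hl : 0 < p.l) (hε : 0 < p.ε₂) (hΔ : p.Δ₂ ≠ 0) :
    0 < p.variance := by
  have hL := log_one_div_δiter_pos hδ
  have hM := half_le_log_div_δiter hδ hl
  have hM' : 0 < Real.log (1.25 / p.δiter) := by linarith
  have hl' : (0 : ℝ) < p.l := by exact_mod_cast hl
  have hεi : 0 < p.εiter := by
    unfold εiter
    positivity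
  unfold variance
  positivity

lemma l_mul_le (hδ : 0 < p.δ₂ ∧ p.δ₂ < 1) (hl : 0 < p.l) (hε : 0 < p.ε₂) :
    p.l * (p.Δ₂ ^ 2 / (2 * p.variance)) ≤
      p.ε₂ ^ 2 / (32 * Real.log (1 / p.δiter) * Real.log (1.25 / p.δiter)) := by
  have hL := log_one_div_δiter_pos hδ
  have hM := half_le_log_div_δiter hδ hl
  have hM' : 0 < Real.log (1.25 / p.δiter) := by linarith
  have hl' : (0 : ℝ) < p.l := by exact_mod_cast hl
  by_cases hΔ : p.Δ₂ = 0
  · rw [hΔ]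
    simp only [ne_eq, OfNat.ofNat_ne_zero, not_false_eq_true, zero_pow, zero_div, mul_zero]
    positivity
  · have hsq : √(2 * (p.l : ℝ) * Real.log (1 / p.δiter)) ^ 2 =
        2 * p.l * Real.log (1 / p.δiter) := Real.sq_sqrt (by positivity)
    refine le_of_eq ?_
    unfold variance εiter
    rw [div_pow, mul_pow _ (√_), hsq]
    field_simp
    norm_num

lemma screening_budget (hδ : 0 < p.δ₂ ∧ p.δ₂ < 1) (hε : 0 < p.ε₂)
    (hreg : p.ε₂ ≤ 8 * Real.log (1 / p.δiter)) :
    ∃ B, 0 ≤ B ∧ p.l * (p.Δ₂ ^ 2 / (2 * p.variance)) ≤ B ∧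
      B + 2 * √(B * Real.log (1 / p.δiter)) ≤ p.ε₂ := by
  rcases Nat.eq_zero_or_pos p.l with hl | hl
  -- Without screenings the budget is zero, and no lower bound on `log (1.25 / δiter)` is needed.
  · exact ⟨0, le_rfl, by simp [hl], by simpa using hε.le⟩
  · have hL := log_one_div_δiter_pos hδ
    have hM := half_le_log_div_δiter hδ hl
    have hM' : 0 < Real.log (1.25 / p.δiter) := by linarith
    exact ⟨_, by positivity, l_mul_le hδ hl hε, gaussian_calibration hε hL hM hreg⟩

end Params

/-! ### Total budget and the screening mechanism -/

lemma sum_budget_le (p : Params d) (x : ℝ) {y : ℝ} (hy : 0 ≤ y) :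
    ∑ s ∈ Finset.range p.T, (x + if s + 1 ∈ p.I then y else 0) ≤ p.T * x + p.l * y := by
  rw [Finset.sum_add_distrib, Finset.sum_const, Finset.card_range, nsmul_eq_mul,
    ← Finset.sum_filter, Finset.sum_const, nsmul_eq_mul]
  -- The summand `s` belongs to iteration `s + 1`, so the shift injects the counted indices into
  -- `p.I`.
  gcongr
  exact Finset.card_le_card_of_injOn (· + 1) (fun s hs => (Finset.mem_filter.1 hs).2)
    fun _ _ _ _ h => Nat.succ_injective h

lemma renyiLE_screen {a : ℝ} (ha : 1 < a) {p : Params d} {D D' : Dataset d} {t : ℕ}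
    {w : EuclideanSpace ℝ (Fin d)}
    (hs : ‖D.screenVector p.lam w - D'.screenVector p.lam w‖ ≤ p.Δ₂)
    (hv : t ∈ p.I → 0 < p.variance ∨ p.Δ₂ = 0) :
    RenyiLE a (if t ∈ p.I then p.Δ₂ ^ 2 / (2 * p.variance) else 0)
      ((gaussianNoise d p.variance).map (screen p D t w))
      ((gaussianNoise d p.variance).map (screen p D' t w)) := by
  by_cases ht : t ∈ p.I
  · have hz : Measurable fun s : EuclideanSpace ℝ (Fin d) => zeroOut s w :=
      measurable_zeroOut.comp (measurable_id.prodMk measurable_const)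
    have h := (RenyiLE.gaussianNoise ha (hv ht) hs).map hz
    rw [Measure.map_map hz (by fun_prop), Measure.map_map hz (by fun_prop)] at h
    have hscreen : ∀ D : Dataset d, screen p D t w =
        (fun s => zeroOut s w) ∘ fun g => D.screenVector p.lam w + WithLp.toLp 2 g := fun D => by
      ext1 g
      simp [screen, ht]
    rw [hscreen D, hscreen D', if_pos ht]
    exact h
  · have hconst : ∀ D : Dataset d, screen p D t w = fun _ => w := fun D => by
      ext1 g
      simp [screen, ht]
    rw [hconst D, hconst D', if_neg ht]
    have := Measure.isProbabilityMeasure_map (μ := gaussianNoise d p.variance)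
      (f := fun _ => w) aemeasurable_const
    exact RenyiLE.refl ha _

variable [NeZero d]

/-! ### Privacy of the iterates -/

/-- The joint law of the Laplace and the Gaussian noise of one iteration on `n` records. -/
abbrev stepNoise (p : Params d) (n : ℕ) : Measure ((Vertex d → ℝ) × (Fin d → ℝ)) :=
  (laplaceNoise (Vertex d) (p.fwScale n)).prod (gaussianNoise d p.variance)

lemma map_iteration_eq (p : Params d) (D : Dataset d) (t : ℕ) (w : EuclideanSpace ℝ (Fin d)) :
    (stepNoise p D.n).map (fun x => iteration p D t w x.1 x.2) =
      ((noisyArgmin (score D p.lam w) (p.fwScale D.n)).prod (gaussianNoise d p.variance)).map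
        fun x => screen p D t (moveTo p.lam (p.stepSize t) w x.1) x.2 := by
  have h1 := measurable_argminIndex_add (score D p.lam w)
  have h2 := measurable_screen_moveTo p D t w
  rw [noisyArgmin]
  conv_rhs => rw [← Measure.map_id (μ := gaussianNoise d p.variance)]
  rw [Measure.map_prod_map _ _ h1 measurable_id, Measure.map_map h2 (h1.prodMap measurable_id)]
  congr 1

/-- The vertex choice is composed with the screening noise. The new iterate is feasible for every
vertex, so the sensitivity bound `hs` applies to it. -/
lemma renyiLE_iteration {a b : ℝ} (ha : 1 < a) {p : Params d} {D D' : Dataset d} {t : ℕ}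
    (hadj : Adjacent D D') (hD : Admissible p.lam D) (hD' : Admissible p.lam D')
    (hlam : 0 < p.lam) (hη : 0 ≤ p.stepSize t ∧ p.stepSize t ≤ 1) (hb : 0 < b)
    (hbn : ∀ n : ℕ, 0 < n → n * p.fwScale n = b)
    (hs : ∀ w ∈ l1Ball d p.lam, ‖D.screenVector p.lam w - D'.screenVector p.lam w‖ ≤ p.Δ₂)
    (hv : t ∈ p.I → 0 < p.variance ∨ p.Δ₂ = 0)
    {w : EuclideanSpace ℝ (Fin d)} (hw : w ∈ l1Ball d p.lam) :
    RenyiLE a ((2 * (4 * p.lam ^ 2) / b) ^ 2 / 2 +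
        if t ∈ p.I then p.Δ₂ ^ 2 / (2 * p.variance) else 0)
      ((stepNoise p D.n).map fun x => iteration p D t w x.1 x.2)
      ((stepNoise p D'.n).map fun x => iteration p D' t w x.1 x.2) := by
  have hscale : ∀ D : Dataset d, 0 < D.n →
      noisyArgmin (score D p.lam w) (p.fwScale D.n) =
        noisyArgmin (fun k => D.n * score D p.lam w k) b := fun D hn => by
    have hn' : (0 : ℝ) < D.n := by exact_mod_cast hn
    have hpos : 0 < p.fwScale D.n := by
      have := hbn D.n hn
      exact pos_of_mul_pos_right (by rw [this]; exact hb) hn'.le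
    rw [← hbn D.n hn, noisyArgmin_mul _ hpos hn']
  rw [map_iteration_eq, map_iteration_eq, hscale D hD.1, hscale D' hD'.1]
  refine RenyiLE.comp ha (measurable_screen_moveTo p D t w)
    (measurable_screen_moveTo p D' t w)
    (RenyiLE.noisyArgmin ha hb (by positivity) fun k => ?_) (ae_of_all _ fun k => ?_)
  · have h := hadj.abs_sub_le hD hD' (vertexPoint_mem hlam.le k) hw
    unfold score
    exact h
  · have h := renyiLE_screen ha (hs _ (moveTo_mem hlam.le hη hw k)) hv
    exact h

lemma isProbabilityMeasure_iterateLaw (p : Params d) (D : Dataset d)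
    (hinit : IsProbabilityMeasure p.init) : ∀ t, IsProbabilityMeasure (iterateLaw p D t)
  | 0 => hinit
  | t + 1 => by
    have := isProbabilityMeasure_iterateLaw p D hinit t
    exact Measure.isProbabilityMeasure_map (measurable_iteration p D (t + 1)).aemeasurable

/-- Both sensitivity bounds hold only on the feasible ball, so composition needs the iterates to
stay there almost surely. -/
lemma ae_iterateLaw_mem (p : Params d) (D : Dataset d) (hlam : 0 ≤ p.lam)
    (hη : ∀ t, 0 ≤ p.stepSize t ∧ p.stepSize t ≤ 1)
    (hball : ∀ᵐ w ∂p.init, w ∈ l1Ball d p.lam) :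
    ∀ t, ∀ᵐ w ∂iterateLaw p D t, w ∈ l1Ball d p.lam
  | 0 => hball
  | t + 1 => by
    have ih := ae_iterateLaw_mem p D hlam hη hball t
    have hm : MeasurableSet (l1Ball d p.lam) := (Dataset.isCompact_l1Ball p.lam).measurableSet
    refine (ae_map_iff (measurable_iteration p D (t + 1)).aemeasurable hm).2 ?_
    filter_upwards [Measure.quasiMeasurePreserving_fst.ae ih] with ω hω
    exact iteration_mem p D (t + 1) hlam (hη _) hω _ _

lemma renyiLE_iterateLaw {a b : ℝ} (ha : 1 < a) {p : Params d} {D D' : Dataset d}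
    (hadj : Adjacent D D') (hD : Admissible p.lam D) (hD' : Admissible p.lam D')
    (hlam : 0 < p.lam) (hη : ∀ t, 0 ≤ p.stepSize t ∧ p.stepSize t ≤ 1)
    (hinit : IsProbabilityMeasure p.init) (hball : ∀ᵐ w ∂p.init, w ∈ l1Ball d p.lam)
    (hb : 0 < p.T → 0 < b) (hbn : ∀ n : ℕ, 0 < n → n * p.fwScale n = b)
    (hs : ∀ w ∈ l1Ball d p.lam, ‖D.screenVector p.lam w - D'.screenVector p.lam w‖ ≤ p.Δ₂)
    (hv : ∀ t ∈ p.I, 0 < p.variance ∨ p.Δ₂ = 0) :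
    ∀ t ≤ p.T, RenyiLE a (∑ s ∈ Finset.range t, ((2 * (4 * p.lam ^ 2) / b) ^ 2 / 2 +
        if s + 1 ∈ p.I then p.Δ₂ ^ 2 / (2 * p.variance) else 0))
      (iterateLaw p D t) (iterateLaw p D' t)
  | 0, _ => by simpa [iterateLaw] using RenyiLE.refl ha p.init
  | t + 1, ht => by
    have ih := renyiLE_iterateLaw ha hadj hD hD' hlam hη hinit hball hb hbn hs hv t (by omega)
    have := isProbabilityMeasure_iterateLaw p D hinit t
    have := isProbabilityMeasure_iterateLaw p D' hinit t
    rw [Finset.sum_range_succ]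
    refine RenyiLE.comp ha (measurable_iteration p D (t + 1)) (measurable_iteration p D' (t + 1))
      ih ?_
    filter_upwards [ae_iterateLaw_mem p D hlam.le hη hball t] with w hw
    exact renyiLE_iteration ha hadj hD hD' hlam (hη _) (hb (by omega)) hbn hs (hv _) hw

end

end ADPScreen

end

/-! ### Assembly of the privacy guarantee -/

theorem mainTheorem3 (d : ℕ) [NeZero d] (p : ADPScreen.Params d)
    (𝒟 : Set (ADPScreen.Dataset d))
    (h_ε₁ : 0 < p.ε₁) (h_ε₂ : 0 < p.ε₂)
    (h_δ₁ : 0 < p.δ₁ ∧ p.δ₁ ≤ 1) (h_δ₂ : 0 < p.δ₂ ∧ p.δ₂ ≤ 1)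
    (h_reg₁ : p.δ₁ < 1 → p.ε₁ ≤ 8 * Real.log (1 / p.δ₁))
    (h_reg₂ : p.δ₂ < 1 → p.ε₂ ≤ 8 * Real.log (1 / p.δiter))
    (h_lam : 0 < p.lam)
    (h_I : p.I ⊆ Finset.Icc 1 p.T)
    (h_step : ∀ t, 0 ≤ p.stepSize t ∧ p.stepSize t ≤ 1)
    (h_init : MeasureTheory.IsProbabilityMeasure p.init)
    (h_initBall : ∀ᵐ w ∂p.init, w ∈ ADPScreen.l1Ball d p.lam)
    (h_adm : ∀ D ∈ 𝒟, ADPScreen.Admissible p.lam D)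
    (h_sens : ADPScreen.HasL2Sensitivity 𝒟 p.lam p.Δ₂) :
    ADPScreen.IsDP 𝒟 (ADPScreen.adpScreen p) (p.ε₁ + p.ε₂) (p.δ₁ + p.δ₂) := by
  intro D hD D' hD' hadj O hO
  have hP := ADPScreen.isProbabilityMeasure_iterateLaw p D h_init p.T
  have hP' := ADPScreen.isProbabilityMeasure_iterateLaw p D' h_init p.T
  unfold ADPScreen.adpScreen
  rcases le_or_gt 1 (p.δ₁ + p.δ₂) with hδ | hδ
  · refine prob_le_one.trans (le_add_left ?_)
    exact ENNReal.one_le_ofReal.2 hδ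
  have hδ₁ : p.δ₁ < 1 := by linarith [h_δ₂.1]
  have hδ₂ : p.δ₂ < 1 := by linarith [h_δ₁.1]
  have hL₁ : 0 < Real.log (1 / p.δ₁) := Real.log_pos (by rw [one_lt_div h_δ₁.1]; exact hδ₁)
  have hδpos : 0 < p.δ₁ + p.δ₂ := add_pos h_δ₁.1 h_δ₂.1
  have hlog₁ : Real.log (1 / (p.δ₁ + p.δ₂)) ≤ Real.log (1 / p.δ₁) :=
    Real.log_le_log (by positivity) (one_div_le_one_div_of_le h_δ₁.1 (by linarith [h_δ₂.1]))
  have hlog₂ : Real.log (1 / (p.δ₁ + p.δ₂)) ≤ Real.log (1 / p.δiter) :=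
    (Real.log_le_log (by positivity)
      (one_div_le_one_div_of_le h_δ₂.1 (by linarith [h_δ₁.1]))).trans
      (ADPScreen.Params.log_one_div_le_δiter h_δ₂.1)
  obtain ⟨B, hB, hBle, hBε⟩ :=
    ADPScreen.Params.screening_budget ⟨h_δ₂.1, hδ₂⟩ h_ε₂ (h_reg₂ hδ₂)
  -- Both mechanisms share this one order, chosen for the combined `δ₁ + δ₂`.
  obtain ⟨a, ha, haε⟩ := ADPScreen.exists_order (by positivity) hB hδpos hδ hlog₁ hlog₂
    (ADPScreen.laplace_calibration h_ε₁ hL₁ (h_reg₁ hδ₁)) hBε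
  have hv : ∀ t ∈ p.I, 0 < p.variance ∨ p.Δ₂ = 0 := fun t ht => by
    by_cases hΔ : p.Δ₂ = 0
    · exact Or.inr hΔ
    · exact Or.inl (ADPScreen.Params.variance_pos ⟨h_δ₂.1, hδ₂⟩ (Finset.card_pos.2 ⟨t, ht⟩)
        h_ε₂ hΔ)
  have hρ : 0 ≤ p.Δ₂ ^ 2 / (2 * p.variance) := by
    rcases p.I.eq_empty_or_nonempty with hI | ⟨t, ht⟩
    -- With no screening, `εiter` and the variance are divisions by zero, hence `0`, and so is the
    -- quotient.
    · simp [ADPScreen.Params.variance, ADPScreen.Params.εiter, ADPScreen.Params.l, hI]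
    · rcases hv t ht with h | h
      · positivity
      · simp [h]
  have key := ADPScreen.renyiLE_iterateLaw ha hadj (h_adm D hD) (h_adm D' hD') h_lam h_step h_init
    h_initBall (ADPScreen.Params.fwBudget_pos h_ε₁ hL₁ h_lam)
    (fun n hn => ADPScreen.Params.mul_fwScale p hn) (h_sens D hD D' hD' hadj) hv p.T le_rfl
  refine (key.mono ha ?_).measure_le ha hδpos haε hO
  exact (ADPScreen.sum_budget_le p _ hρ).trans
    (add_le_add (ADPScreen.Params.T_mul_le h_ε₁ hL₁ h_lam) hBle)
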